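/- **Model.** A link $i$ is a pair of a sender $s_i$ and a receiver $r_i$ in the plane, of length $l_i=d(s_i,r_i)$. All senders use power $P>0$. Let $\alpha>2$ be the path-loss exponent and $\beta\ge1$ the threshold. For a set $L$ of $n$ links we assume $s_j\ne r_i$ for all $i,j$, and put $\bar{\mathcal S}_i=P/l_i^{\alpha}$ and $\bar{\mathcal I}_{ji}=P/d(s_j,r_i)^{\alpha}$. A stochastic shadowing distribution $\mathcal D$ is a family $(\mathcal D_m)_{m>0}$ of probability distributions on $[0,\infty)$, where $\mathcal D_m$ has mean $m$. Under $\mathcal D$, the signal strengths $\mathcal S_i$ and the interferences $\mathcal I_{ji}$ ($j\neq i$) are independent random variables with laws $\mathcal D_{\bar{\mathcal S}_i}$ and $\mathcal D_{\bar{\mathcal I}_{ji}}$. A set $S\subseteq L$ is *feasible* if $\mathcal S_i>\beta\sum_{j\in S\setminus i}\mathcal I_{ji}$ for every $i\in S$, and $\mathrm{OPT}^{\mathcal D}(L)$ is the maximum size of a feasible subset of $L$. The *affectance* of $S$ on $j$ is $a_S(j)=\sum_{i\in S\setminus j}\mathcal I_{ij}/\mathcal S_j$. $\mathcal D$ is *$p$-smooth*,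 for $p\in(0,1)$, if there is $c_0>0$ such that for every $m>0$ there is $x\ge c_0m$ with $\mathcal D_m((x,\infty))=p$. Let $f_m(t)=\mathcal D_m((tm,\infty))$ and $g_n(m)=\max\{1,g'_n(m)\}$, where $g'_n(m)$ is the maximal (in general, the supremum; $0$ if there is none) $t\ge0$ with $f_m(t)\in[t/n,2t/n]$. The condition $g_n=\Omega(\log n)$ means that for some $\kappa>0$ and $N$, $g_n(m)\ge\kappa\log n$ for all $n\ge N$ and $m>0$. A set of links is *equilength* if $l_i<2l_j$ for all its links $i,j$. A *cluster* is an equilength set whose senders lie in a square of side half its minimum length. An equilength set is *well-separated* if it is a disjoint union of clusters such that $\min\{d(s_i,r_j),d(s_j,r_i)\}$ exceeds the minimum length of the set for all $i,j$ in different clusters. **Algorithm** (with a parameter $c>0$, for an equilength set $L$). 1. Cut the plane by a grid of horizontal and vertical lines, at any position, into half-open squares of side $\frac12\min_{i\in L}l_i$ with integer coordinates. Split $L$ into $81$ subsets according to the coordinates modulo $9$ of the square of the sender. In each subset, the links with senders in a common square form a cluster. 2. For each cluster $C$ of a subset $L'$, go through $C$ in decreasing order of signal strength (ties in the order of the link numbers)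 and add $i$ to $S_C$, initially empty, if $\mathcal S_i>2\beta|S_C|\,P/(\min_{j\in C}l_j)^{\alpha}$. Let $S=\bigcup_C S_C$ and $R=\{j\in S:\ a_S(j)<2c\}$. 3. Partition $R$ into at most $\lceil 4c\beta\rceil$ feasible sets in any way and let a largest of them be the solution for $L'$. 4. Output as $ALG$ a largest of the $81$ solutions. **Theorem.** Let $\alpha>2$, $\beta\ge1$, $p\in(0,1)$, and let $\mathcal D$ be a $p$-smooth shadowing distribution with $g_n=\Omega(\log n)$. There are constants $c,A,B>0$ (depending only on $\alpha,\beta,p,\mathcal D$) such that for every $P>0$, every $n$, every equilength set $L$ of $n$ links in the plane as above, and every position of the grid: the $81$ subsets of step 1 are well-separated, as the unions of their clusters; almost surely all steps of the algorithm with parameter $c$ can be carried out, and its output can be chosen as a random variable; and every random output $ALG$ satisfies $$A\cdot\mathbb E[\mathrm{OPT}^{\mathcal D}(L)]\ \le\ \mathbb E[|ALG|]\ \le\ B\cdot\mathbb E[\mathrm{OPT}^{\mathcal D}(L)],$$ that is, $\mathbb E[|ALG|]=\Theta(\mathbb E[\mathrm{OPT}^{\mathcal D}(L)])$. -/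

import Mathlib

open MeasureTheory ProbabilityTheory

noncomputable section

/-- The Euclidean plane. -/
abbrev Plane : Type := EuclideanSpace ℝ (Fin 2)

/-- `n` communication links, numbered by `Fin n`: link `i` is a sender node and a receiver node. -/
structure LinkSet (n : ℕ) where
  sender : Fin n → Plane
  receiver : Fin n → Plane

namespace LinkSet

variable {n : ℕ} (L : LinkSet n)

/-- The length of link `i`. -/
def len (i : Fin n) : ℝ := dist (L.sender i) (L.receiver i)

/-- The minimum length of the links in a (nonempty) set `T`. -/
def minLen (T : Finset (Fin n)) : ℝ := sInf (L.len '' (T : Set (Fin n)))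

/-- Geometric path-loss: the power received at the receiver of link `i` when the sender of link `j`
transmits with power `P`. For `j = i` it is the signal strength of link `i`, for `j ≠ i` it is the
interference of link `j` on link `i`. -/
def gain (P α : ℝ) (j i : Fin n) : ℝ := P / dist (L.sender j) (L.receiver i) ^ α

/-- The ratio of any two lengths of links in `T` is less than two. -/
def Equilength (T : Finset (Fin n)) : Prop := ∀ i ∈ T, ∀ j ∈ T, L.len i < 2 * L.len j

/-- An equilength set is a cluster if some square (with a vertex `a` and orthonormal side directions
`u`, `v`) of side length half the minimum link length contains all the sender nodes. -/
def IsCluster (T : Finset (Fin n)) : Prop :=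
  L.Equilength T ∧ ∃ a u v : Plane, ‖u‖ = 1 ∧ ‖v‖ = 1 ∧ inner ℝ u v = 0 ∧ ∀ i ∈ T,
    inner ℝ (L.sender i - a) u ∈ Set.Icc 0 (L.minLen T / 2) ∧
    inner ℝ (L.sender i - a) v ∈ Set.Icc 0 (L.minLen T / 2)

/-- The equilength set `T` is well-separated, as the disjoint union of the clusters in `𝒞`. -/
def IsWellSeparated (T : Finset (Fin n)) (𝒞 : Finset (Finset (Fin n))) : Prop :=
  L.Equilength T ∧ 𝒞.biUnion id = T ∧
  (∀ C ∈ 𝒞, L.IsCluster C) ∧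
  ∀ C ∈ 𝒞, ∀ C' ∈ 𝒞, C ≠ C' → Disjoint C C' ∧ ∀ i ∈ C, ∀ j ∈ C',
    L.minLen T < min (dist (L.sender i) (L.receiver j)) (dist (L.sender j) (L.receiver i))

/-- The plane is cut into (half-open) squares by horizontal and vertical lines at distance `ℓ / 2`,
where `ℓ` is the minimum link length; the grid is positioned by one of its vertices, `o`. This is the
pair of integer coordinates of the square that contains the sender of link `i`. -/
def square (o : Plane) (i : Fin n) : ℤ × ℤ :=
  (⌊(L.sender i 0 - o 0) / (L.minLen Finset.univ / 2)⌋,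
   ⌊(L.sender i 1 - o 1) / (L.minLen Finset.univ / 2)⌋)

/-- The links whose sender is in a square with coordinates congruent to `q` modulo 9: these are the 81
subsets into which the algorithm splits the links. -/
def gridClass (o : Plane) (q : ZMod 9 × ZMod 9) : Finset (Fin n) :=
  {i | (((L.square o i).1 : ZMod 9), ((L.square o i).2 : ZMod 9)) = q}

/-- The clusters of the subset `gridClass o q`: the links with senders in a common square. -/
def clusters (o : Plane) (q : ZMod 9 × ZMod 9) : Finset (Finset (Fin n)) :=
  (L.gridClass o q).image fun i => {j ∈ L.gridClass o q | L.square o j = L.square o i}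

end LinkSet

/-- A stochastic shadowing distribution: a distribution on the nonnegative reals that is parametrized
by its mean `m > 0`. -/
structure SSDistribution where
  law : ℝ → Measure ℝ
  isProbabilityMeasure : ∀ m, 0 < m → IsProbabilityMeasure (law m)
  nonneg : ∀ m, 0 < m → ∀ᵐ x ∂law m, 0 ≤ x
  integrable : ∀ m, 0 < m → Integrable (fun x => x) (law m)
  mean : ∀ m, 0 < m → ∫ x, x ∂law m = m

namespace SSDistribution

variable (D : SSDistribution)

/-- For a constant `c > 0`, the `(1 - p)`-quantile of the law of mean `m` is at least `c * m`. -/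
def IsSmooth (p : ℝ) : Prop :=
  ∃ c : ℝ, 0 < c ∧ ∀ m, 0 < m → ∃ x, (D.law m).real (Set.Ioi x) = p ∧ c * m ≤ x

/-- The probability `f t` that a power of mean `m` exceeds `t` times its mean. -/
def tail (m t : ℝ) : ℝ := (D.law m).real (Set.Ioi (t * m))

/-- `g n = max 1 g'`, where `g'` is the maximal `t ≥ 0` with `t / n ≤ f t ≤ 2 * t / n`. -/
def g (m : ℝ) (n : ℕ) : ℝ :=
  max 1 (sSup {t : ℝ | 0 ≤ t ∧ D.tail m t ∈ Set.Icc (t / n) (2 * t / n)})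

/-- `g n = Ω(log n)`, with constants that do not depend on the mean. -/
def HasLogGrowth : Prop :=
  ∃ κ : ℝ, 0 < κ ∧ ∃ N : ℕ, ∀ n ≥ N, ∀ m, 0 < m → κ * Real.log n ≤ D.g m n

end SSDistribution

/-! In the following, `x j i` is the power received at the receiver of link `i` from the sender of
link `j`: the signal strength of link `i` is `x i i`, the interference of `j` on `i ≠ j` is `x j i`. -/

section Algorithm

variable {n : ℕ}

/-- Every link of `S` has a signal to interference ratio greater than `β` when `S` transmits. -/
def IsFeasible (β : ℝ) (x : Fin n → Fin n → ℝ) (S : Finset (Fin n)) : Prop :=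
  ∀ i ∈ S, β * ∑ j ∈ S.erase i, x j i < x i i

open Classical in
/-- The maximum number of links in a feasible set. -/
def opt (β : ℝ) (x : Fin n → Fin n → ℝ) : ℕ :=
  (Finset.univ.filter fun S : Finset (Fin n) => IsFeasible β x S).sup Finset.card

/-- The affectance of `S` on link `j`. -/
def affectance (x : Fin n → Fin n → ℝ) (S : Finset (Fin n)) (j : Fin n) : ℝ :=
  ∑ i ∈ S.erase j, x i j / x j j

open Classical in
/-- The links of `T` in decreasing order of signal strength (ties are in the order of the numbers:
insertion sort is stable). -/
def byStrength (x : Fin n → Fin n → ℝ) (T : Finset (Fin n)) : List (Fin n) :=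
  (T.sort (· ≤ ·)).insertionSort fun i j => x j j ≤ x i i

open Classical in
/-- The set constructed by the cluster algorithm on `T`: in decreasing order of signal strength, link
`i` is added to `S` if its strength exceeds `2 * β * |S| * s`, where `s` is the path-loss signal
strength of a link of the minimum length in `T`. -/
def clusterSelect (L : LinkSet n) (P α β : ℝ) (x : Fin n → Fin n → ℝ) (T : Finset (Fin n)) :
    Finset (Fin n) :=
  (byStrength x T).foldl
    (fun S i => if 2 * β * (S.card : ℝ) * (P / L.minLen T ^ α) < x i i then insert i S else S) ∅

/-- The union of the sets that the cluster algorithm constructs on the clusters of one of the 81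
well-separated subsets. -/
def selected (L : LinkSet n) (P α β : ℝ) (o : Plane) (x : Fin n → Fin n → ℝ)
    (q : ZMod 9 × ZMod 9) : Finset (Fin n) :=
  (L.clusters o q).biUnion (clusterSelect L P α β x)

open Classical in
/-- The selected links on which the selected set has affectance less than `2 * c`. -/
def sparsified (L : LinkSet n) (P α β c : ℝ) (o : Plane) (x : Fin n → Fin n → ℝ)
    (q : ZMod 9 × ZMod 9) : Finset (Fin n) :=
  (selected L P α β o x q).filter fun j => affectance x (selected L P α β o x q) j < 2 * c

/-- `A` is a largest class of a partition of `R` into at most `k` feasible sets (the classes of the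
family may be empty). -/
def IsLargestFeasiblePart (β : ℝ) (x : Fin n → Fin n → ℝ) (k : ℕ) (R A : Finset (Fin n)) : Prop :=
  ∃ part : Fin k → Finset (Fin n),
    (∀ r r', r ≠ r' → Disjoint (part r) (part r')) ∧
    Finset.univ.biUnion part = R ∧
    (∀ r, IsFeasible β x (part r)) ∧
    (∃ r, A = part r) ∧ ∀ r, (part r).card ≤ A.card

/-- `A` is a possible output of the algorithm with parameter `c` on received powers `x`: for each of the
81 well-separated subsets, the sparsified set is partitioned into at most `⌈4 * c * β⌉` feasible sets,
the largest of them is the solution for that subset, and `A` is a solution of maximum size. -/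
def IsOutput (L : LinkSet n) (P α β c : ℝ) (o : Plane) (x : Fin n → Fin n → ℝ)
    (A : Finset (Fin n)) : Prop :=
  ∃ sol : ZMod 9 × ZMod 9 → Finset (Fin n),
    (∀ q, IsLargestFeasiblePart β x ⌈4 * c * β⌉₊ (sparsified L P α β c o x q) (sol q)) ∧
    (∃ q, A = sol q) ∧ ∀ q, (sol q).card ≤ A.card

end Algorithm

section Random

variable {n : ℕ} {Ω : Type*} [MeasurableSpace Ω]

/-- The random received powers `X j i` follow the shadowing model with distribution `D`: they are
independent, and each has the law of `D` whose mean is its value under geometric path-loss. -/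
structure IsShadowing (D : SSDistribution) (L : LinkSet n) (P α : ℝ) (μ : Measure Ω)
    (X : Fin n → Fin n → Ω → ℝ) : Prop where
  measurable : ∀ j i, Measurable (X j i)
  indep : iIndepFun (fun q : Fin n × Fin n => X q.1 q.2) μ
  law : ∀ j i, μ.map (X j i) = D.law (L.gain P α j i)

/-- `ALG` is a random set that is almost surely an output of the algorithm on the random powers. -/
structure IsRun (L : LinkSet n) (P α β c : ℝ) (o : Plane) (μ : Measure Ω)
    (X : Fin n → Fin n → Ω → ℝ) (ALG : Ω → Finset (Fin n)) : Prop where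
  measurable : ∀ A, MeasurableSet {ω | ALG ω = A}
  output : ∀ᵐ ω ∂μ, IsOutput L P α β c o (fun j i => X j i ω) (ALG ω)

end Random

end

/-!
Selecting greedily in each cluster loses only a constant factor against the optimum, in expectation.
If `S` is feasible in a cluster, all links of `S` interfere with each other at about the strength of
the path-loss signal, unless shadowing weakens the interference. By smoothness a constant fraction
of the pairs has strong interference, and a Chernoff bound makes this uniform over all sets of size
at least a constant times `log n`. A feasible set larger than that therefore contains many links
whose strength is proportional to its size, and the greedy set is of comparable size; the growth of
`g n` is what makes the greedy set of size `log n` in expectation, which pays for the small sets.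

Every link discarded at the end has large affectance. The selected sets are functions of the signal
strengths, which are independent of the interferences, so expected affectance is computed with the
geometric interferences. As a selected link of a cluster has strength proportional to the number of
links selected there, one sender contributes to all of them at most a sum of `(1 + d) ^ (-α)` over
the squares of the grid, which converges for `α > 2`. Markov's inequality leaves half of the links.
They split into `⌈4 * c * β⌉₊` feasible sets: a positive left eigenvector of the interference
matrix, normalized by the strengths, turns it into symmetric weights with controlled row sums, and a
colouring of minimum total monochromatic weight is then good in every row.
-/

section Coloring

open Finset Matrix

variable {ι κ : Type*} [Fintype ι]

theorem exists_ne_zero_vecMul_eq_smul {K : Type*} [Field K] [Nonempty ι] {M : Matrix ι ι K} {W : K}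
    (hM : ∀ i, ∑ j, M i j = W) : ∃ v : ι → K, v ≠ 0 ∧ v ᵥ* M = W • v := by
  classical
  have hright : (M - W • 1) *ᵥ 1 = 0 := by
    ext i
    rw [sub_mulVec, smul_mulVec, one_mulVec]
    simp [mulVec, dotProduct, hM]
  obtain ⟨v, hv, hleft⟩ := exists_vecMul_eq_zero_iff.2
    (exists_mulVec_eq_zero_iff.1 ⟨1, one_ne_zero, hright⟩)
  exact ⟨v, hv, by simpa [vecMul_sub, vecMul_smul, sub_eq_zero] using hleft⟩

/- Taking absolute values in a left eigenvector cannot decrease any entry of `v ᵥ* M`, and it does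
not change their sum, so the absolute values form an eigenvector as well. -/
theorem exists_pos_vecMul_eq_smul [Nonempty ι] {M : Matrix ι ι ℝ} {W : ℝ} (hpos : ∀ i j, 0 < M i j)
    (hM : ∀ i, ∑ j, M i j = W) : ∃ v : ι → ℝ, (∀ i, 0 < v i) ∧ v ᵥ* M = W • v := by
  have hW : 0 < W := by
    rw [← hM (Classical.arbitrary ι)]
    exact sum_pos (fun j _ => hpos _ j) univ_nonempty
  obtain ⟨v, hv, heig⟩ := exists_ne_zero_vecMul_eq_smul hM
  have heig' (j : ι) : ∑ i, v i * M i j = W * v j := congrFun heig j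
  have hle (j : ι) : W * |v j| ≤ ∑ i, |v i| * M i j :=
    calc W * |v j| = |∑ i, v i * M i j| := by rw [heig', abs_mul, abs_of_pos hW]
      _ ≤ ∑ i, |v i * M i j| := abs_sum_le_sum_abs _ _
      _ = ∑ i, |v i| * M i j := by simp only [abs_mul, abs_of_pos (hpos _ _)]
  have hsum : ∑ j, W * |v j| = ∑ j, ∑ i, |v i| * M i j := by
    rw [sum_comm]
    simp_rw [← mul_sum, hM, ← sum_mul, mul_comm]
  have heq (j : ι) : W * |v j| = ∑ i, |v i| * M i j :=
    (sum_eq_sum_iff_of_le fun j _ => hle j).1 hsum j (mem_univ j)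
  obtain ⟨i₀, hi₀⟩ := Function.ne_iff.1 hv
  refine ⟨fun i => |v i|, fun j => pos_of_mul_pos_right (a := W) ?_ hW.le,
    funext fun j => (heq j).symm⟩
  rw [heq]
  exact sum_pos' (fun i _ => mul_nonneg (abs_nonneg _) (hpos i j).le)
    ⟨i₀, mem_univ _, mul_pos (abs_pos.2 hi₀) (hpos i₀ j)⟩

variable [DecidableEq ι] [DecidableEq κ]

/-- The weight in row `i` of the weights `w` that goes to other vertices of the colour of `i`: the
quantity that a colouring `f` into few feasible sets has to keep small. -/
def monochromaticWeight (w : ι → ι → ℝ) (f : ι → κ) (i : ι) : ℝ :=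
  ∑ j ∈ univ.erase i with f j = f i, w i j

theorem sum_monochromaticWeight {w : ι → ι → ℝ} (hw : ∀ i j, w i j = w j i) (f : ι → κ) (i : ι) :
    ∑ a, monochromaticWeight w f a = 2 * monochromaticWeight w f i +
      ∑ a ∈ univ.erase i, ∑ j ∈ (univ.erase a).erase i, if f j = f a then w a j else 0 := by
  have split_at (a : ι) (ha : a ∈ univ.erase i) : monochromaticWeight w f a =
      (if f a = f i then w i a else 0) +
        ∑ j ∈ (univ.erase a).erase i, if f j = f a then w a j else 0 := by
    have hi : i ∈ univ.erase a := mem_erase.2 ⟨(ne_of_mem_erase ha).symm, mem_univ i⟩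
    rw [monochromaticWeight, sum_filter, ← add_sum_erase _ _ hi, hw a i]
    simp only [eq_comm]
  rw [← add_sum_erase _ _ (mem_univ i), sum_congr rfl split_at, sum_add_distrib, ← sum_filter,
    ← monochromaticWeight]
  ring

/- In a colouring of minimum total monochromatic weight, no vertex profits from a change of its own
colour. -/
theorem exists_coloring_le_average [Fintype κ] [Nonempty κ] {w : ι → ι → ℝ}
    (hw : ∀ i j, w i j = w j i) :
    ∃ f : ι → κ, ∀ i,
      Fintype.card κ * monochromaticWeight w f i ≤ ∑ j ∈ univ.erase i, w i j := by
  obtain ⟨f, hf⟩ := Finite.exists_min fun f : ι → κ => ∑ i, monochromaticWeight w f i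
  refine ⟨f, fun i => ?_⟩
  have recolor (r : κ) : monochromaticWeight w f i ≤ ∑ j ∈ univ.erase i with f j = r, w i j := by
    have hmin := hf (Function.update f i r)
    have hrow : monochromaticWeight w (Function.update f i r) i =
        ∑ j ∈ univ.erase i with f j = r, w i j := by
      rw [monochromaticWeight, Function.update_self]
      refine sum_congr (filter_congr fun j hj => ?_) fun _ _ => rfl
      rw [Function.update_of_ne (ne_of_mem_erase hj)]
    have hrest : (∑ a ∈ univ.erase i, ∑ j ∈ (univ.erase a).erase i,
          if Function.update f i r j = Function.update f i r a then w a j else 0) =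
        ∑ a ∈ univ.erase i, ∑ j ∈ (univ.erase a).erase i, if f j = f a then w a j else 0 := by
      refine sum_congr rfl fun a ha => sum_congr rfl fun j hj => ?_
      rw [Function.update_of_ne (ne_of_mem_erase hj), Function.update_of_ne (ne_of_mem_erase ha)]
    rw [sum_monochromaticWeight hw f i, sum_monochromaticWeight hw _ i, hrow, hrest] at hmin
    linarith
  calc Fintype.card κ * monochromaticWeight w f i = ∑ _r : κ, monochromaticWeight w f i := by
        rw [sum_const, card_univ, nsmul_eq_mul]
    _ ≤ ∑ r : κ, ∑ j ∈ univ.erase i with f j = r, w i j := sum_le_sum fun r _ => recolor r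
    _ = ∑ j ∈ univ.erase i, w i j := sum_fiberwise _ _ _

/- With a positive left eigenvector `v`, the symmetric weights `v i * w i j + v j * w j i` have row
sums `2 * W * v i` and dominate `v i * w i j`. -/
theorem exists_coloring_lt_of_pos [Fintype κ] [Nonempty κ] {w : ι → ι → ℝ} {W : ℝ}
    (hpos : ∀ i j, 0 < w i j) (hW : ∀ i, ∑ j, w i j = W) :
    ∃ f : ι → κ, ∀ i, Fintype.card κ * monochromaticWeight w f i < 2 * W := by
  rcases isEmpty_or_nonempty ι with _ | _
  · exact ⟨isEmptyElim, isEmptyElim⟩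
  obtain ⟨v, hv, heig⟩ := exists_pos_vecMul_eq_smul (M := w) hpos hW
  have heig' (j : ι) : ∑ i, v i * w i j = W * v j := congrFun heig j
  let b : ι → ι → ℝ := fun i j => v i * w i j + v j * w j i
  obtain ⟨f, hf⟩ := exists_coloring_le_average (κ := κ) (w := b) fun i j => add_comm _ _
  refine ⟨f, fun i => lt_of_mul_lt_mul_left ?_ (hv i).le⟩
  have hrow : ∑ j ∈ univ.erase i, b i j < ∑ j, b i j := by
    rw [← add_sum_erase _ _ (mem_univ i)]
    exact lt_add_of_pos_left _ (by have := hv i; have := hpos i i; positivity)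
  have hle : v i * monochromaticWeight w f i ≤ monochromaticWeight b f i := by
    rw [monochromaticWeight, mul_sum]
    exact sum_le_sum fun j _ => le_add_of_nonneg_right (mul_pos (hv j) (hpos j i)).le
  calc v i * (Fintype.card κ * monochromaticWeight w f i)
      = Fintype.card κ * (v i * monochromaticWeight w f i) := by ring
    _ ≤ Fintype.card κ * monochromaticWeight b f i := by gcongr
    _ ≤ ∑ j ∈ univ.erase i, b i j := hf i
    _ < ∑ j, b i j := hrow
    _ = v i * (2 * W) := by
        rw [sum_add_distrib, ← mul_sum, hW, heig']
        ring

theorem exists_coloring_lt [Fintype κ] [Nonempty κ] {w : ι → ι → ℝ} {W : ℝ}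
    (hw : ∀ i j, 0 ≤ w i j) (hW : ∀ i, ∑ j ∈ univ.erase i, w i j < W) :
    ∃ f : ι → κ, ∀ i, Fintype.card κ * monochromaticWeight w f i < 2 * W := by
  -- The slack of each row is spread over the row.
  let slack (i : ι) : ℝ := (W - ∑ j ∈ univ.erase i, w i j) / Fintype.card ι
  let M : ι → ι → ℝ := fun i j => (if j = i then 0 else w i j) + slack i
  have hslack (i : ι) : 0 < slack i :=
    div_pos (sub_pos.2 (hW i)) (Nat.cast_pos.2 (Fintype.card_pos_iff.2 ⟨i⟩))
  have hpos (i j : ι) : 0 < M i j :=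
    add_pos_of_nonneg_of_pos (by split_ifs <;> simp [hw]) (hslack i)
  have hM (i : ι) : ∑ j, M i j = W := by
    have : Nonempty ι := ⟨i⟩
    have hoff : ∑ j ∈ univ.erase i, (if j = i then 0 else w i j) = ∑ j ∈ univ.erase i, w i j :=
      sum_congr rfl fun j hj => if_neg (ne_of_mem_erase hj)
    rw [sum_add_distrib, sum_const, card_univ, nsmul_eq_mul, mul_div_cancel₀ _ (by simp),
      ← add_sum_erase _ _ (mem_univ i), if_pos rfl, hoff]
    ring
  obtain ⟨f, hf⟩ := exists_coloring_lt_of_pos (κ := κ) hpos hM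
  refine ⟨f, fun i => (mul_le_mul_of_nonneg_left ?_ (Nat.cast_nonneg _)).trans_lt (hf i)⟩
  refine sum_le_sum fun j hj => ?_
  simp only [M, if_neg (ne_of_mem_erase (mem_filter.1 hj).1)]
  exact le_add_of_nonneg_right (hslack i).le

end Coloring

section ColoringOn

open Finset

variable {ι κ : Type*} [DecidableEq ι] [DecidableEq κ]

theorem exists_coloring_lt_on [Fintype κ] [Nonempty κ] {w : ι → ι → ℝ} {W : ℝ} {R : Finset ι}
    (hw : ∀ i ∈ R, ∀ j ∈ R, 0 ≤ w i j) (hW : ∀ i ∈ R, ∑ j ∈ R.erase i, w i j < W) :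
    ∃ f : ι → κ, ∀ i ∈ R, Fintype.card κ * ∑ j ∈ R.erase i with f j = f i, w i j < 2 * W := by
  have sum_subtype (i : R) (p : ι → Prop) [DecidablePred p] :
      ∑ j ∈ (univ.erase i).filter fun j : R => p j, w i j = ∑ j ∈ R.erase i with p j, w i j := by
    refine sum_nbij (fun j : R => (j : ι)) ?_ Subtype.val_injective.injOn ?_ fun _ _ => rfl
    · intro j hj
      obtain ⟨hj, hp⟩ := mem_filter.1 hj
      exact mem_filter.2
        ⟨mem_erase.2 ⟨fun h => ne_of_mem_erase hj (Subtype.ext h), j.2⟩, hp⟩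
    · intro j hj
      obtain ⟨hj, hp⟩ := mem_filter.1 hj
      exact ⟨⟨j, mem_of_mem_erase hj⟩, mem_filter.2 ⟨mem_erase.2
        ⟨fun h => ne_of_mem_erase hj (congrArg Subtype.val h), mem_univ _⟩, hp⟩, rfl⟩
  obtain ⟨f, hf⟩ := exists_coloring_lt (ι := R) (κ := κ) (w := fun i j => w i j) (W := W)
    (fun i j => hw i i.2 j j.2) fun i => by
      simpa using (sum_subtype i fun _ => True).trans_lt (by simpa using hW i i.2)
  let g (i : ι) : κ := if hi : i ∈ R then f ⟨i, hi⟩ else Classical.arbitrary κ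
  have hg (i : R) : g i = f i := dif_pos i.2
  refine ⟨g, fun i hi => ?_⟩
  have hcol := hf ⟨i, hi⟩
  simp only [monochromaticWeight, ← hg] at hcol
  rwa [sum_subtype ⟨i, hi⟩ fun j => g j = g i] at hcol

end ColoringOn

section FeasiblePartition

open Finset

variable {n : ℕ} {β : ℝ} {x : Fin n → Fin n → ℝ} {R A : Finset (Fin n)}

theorem exists_isLargestFeasiblePart {c : ℝ} (hβ : 0 < β) (hc : 0 < c) (hx : ∀ j i, 0 ≤ x j i)
    (hpos : ∀ j ∈ R, 0 < x j j) (haff : ∀ j ∈ R, affectance x R j < 2 * c) :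
    ∃ A, IsLargestFeasiblePart β x ⌈4 * c * β⌉₊ R A := by
  have hk : 0 < ⌈4 * c * β⌉₊ := Nat.ceil_pos.2 (by positivity)
  have : Nonempty (Fin ⌈4 * c * β⌉₊) := ⟨⟨0, hk⟩⟩
  obtain ⟨f, hf⟩ := exists_coloring_lt_on (κ := Fin ⌈4 * c * β⌉₊) (w := fun i j => x j i / x i i)
    (fun i _ j _ => div_nonneg (hx j i) (hx i i)) haff
  let part (r : Fin ⌈4 * c * β⌉₊) : Finset (Fin n) := {i ∈ R | f i = r}
  have hfeasible (r) : IsFeasible β x (part r) := by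
    intro i hi
    obtain ⟨hiR, rfl⟩ := mem_filter.1 hi
    have hpart : (part (f i)).erase i = {j ∈ R.erase i | f j = f i} := filter_erase .. |>.symm
    have hcol := hf i hiR
    simp only [Fintype.card_fin, ← sum_div, ← mul_div_assoc, div_lt_iff₀ (hpos i hiR)] at hcol
    rw [hpart]
    have hsum : 0 ≤ ∑ j ∈ R.erase i with f j = f i, x j i := sum_nonneg fun j _ => hx j i
    have hceil : 4 * c * β * ∑ j ∈ R.erase i with f j = f i, x j i < 2 * (2 * c) * x i i :=
      (mul_le_mul_of_nonneg_right (Nat.le_ceil _) hsum).trans_lt hcol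
    exact lt_of_mul_lt_mul_left (a := 4 * c) (by linarith) (by positivity)
  obtain ⟨r₀, hr₀⟩ := Finite.exists_max fun r => (part r).card
  refine ⟨part r₀, part, fun r r' hr => ?_, ?_, hfeasible, ⟨r₀, rfl⟩, hr₀⟩
  · exact disjoint_filter.2 fun i _ h h' => hr (h.symm.trans h')
  · ext i
    simp [part]

theorem IsLargestFeasiblePart.card_le {k : ℕ} (h : IsLargestFeasiblePart β x k R A) :
    R.card ≤ k * A.card := by
  obtain ⟨part, -, rfl, -, -, hmax⟩ := h
  simpa using card_biUnion_le_card_mul univ part _ fun r _ => hmax r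

theorem IsLargestFeasiblePart.isFeasible {k : ℕ} (h : IsLargestFeasiblePart β x k R A) :
    IsFeasible β x A := by
  obtain ⟨part, -, -, hf, ⟨r, rfl⟩, -⟩ := h
  exact hf r

theorem IsFeasible.mono {S T : Finset (Fin n)} (hS : IsFeasible β x S) (hβ : 0 ≤ β)
    (hx : ∀ j i, 0 ≤ x j i) (hT : T ⊆ S) : IsFeasible β x T := fun i hi =>
  (mul_le_mul_of_nonneg_left (sum_le_sum_of_subset_of_nonneg
    (erase_subset_erase i hT) fun j _ _ => hx j i) hβ).trans_lt (hS i (hT hi))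

theorem affectance_nonneg (hx : ∀ j i, 0 ≤ x j i) (S : Finset (Fin n)) (j : Fin n) :
    0 ≤ affectance x S j :=
  sum_nonneg fun i _ => div_nonneg (hx i j) (hx j j)

theorem affectance_mono (hx : ∀ j i, 0 ≤ x j i) {S T : Finset (Fin n)} (hST : S ⊆ T) (j : Fin n) :
    affectance x S j ≤ affectance x T j :=
  sum_le_sum_of_subset_of_nonneg (erase_subset_erase j hST) fun i _ _ =>
    div_nonneg (hx i j) (hx j j)

theorem opt_le (β : ℝ) (x : Fin n → Fin n → ℝ) : opt β x ≤ n :=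
  Finset.sup_le fun S _ => (card_le_univ S).trans_eq (Fintype.card_fin n)

theorem IsFeasible.card_le_opt {S : Finset (Fin n)} (h : IsFeasible β x S) :
    S.card ≤ opt β x := by
  classical
  exact le_sup (f := card) (mem_filter.2 ⟨mem_univ S, h⟩)

end FeasiblePartition

section Greedy

open Finset

variable {ι R : Type*} [DecidableEq ι] [LinearOrder R]

/-- The greedy selection from a list: `i` is added to the current set `S` if its value exceeds the
threshold `t` for the size of `S`. -/
def greedySelect (t : ℕ → R) (y : ι → R) (l : List ι) (S : Finset ι) : Finset ι :=
  l.foldl (fun S i => if t S.card < y i then insert i S else S) S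

variable {t : ℕ → R} {y : ι → R}

theorem greedySelect_eq_self {l : List ι} {S : Finset ι} (h : ∀ i ∈ l, y i ≤ t S.card) :
    greedySelect t y l S = S := by
  induction l with
  | nil => rfl
  | cons a l ih =>
    rw [greedySelect, List.foldl_cons, if_neg (h a List.mem_cons_self).not_gt]
    exact ih fun i hi => h i (List.mem_cons_of_mem a hi)

/- On a decreasing list everything after the first rejected entry is rejected as well. -/
theorem exists_greedySelect_eq_prefix (ht : Monotone t) {l : List ι}
    (hl : l.Pairwise fun i j => y j ≤ y i) (S : Finset ι) :
    ∃ l₁ l₂, l = l₁ ++ l₂ ∧ greedySelect t y l S = S ∪ l₁.toFinset ∧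
      (∀ i ∈ l₁, ∀ k < (greedySelect t y l S).card, t k < y i) ∧
      ∀ i ∈ l₂, y i ≤ t (greedySelect t y l S).card := by
  induction l generalizing S with
  | nil => exact ⟨[], [], by simp [greedySelect]⟩
  | cons a l ih =>
    obtain ⟨ha, hl⟩ := List.pairwise_cons.1 hl
    by_cases hadd : t S.card < y a
    · have hstep : greedySelect t y (a :: l) S = greedySelect t y l (insert a S) := by
        rw [greedySelect, List.foldl_cons, if_pos hadd, greedySelect]
      obtain ⟨l₁, l₂, rfl, hT, haccept, hreject⟩ := ih hl (insert a S)
      rw [hstep]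
      refine ⟨a :: l₁, l₂, rfl, by simp [hT], List.forall_mem_cons.2 ⟨fun k hk => ?_, haccept⟩,
        hreject⟩
      rcases l₁ with _ | ⟨b, l₁⟩
      · rw [hT, List.toFinset_nil, union_empty] at hk
        exact (ht (Nat.lt_succ_iff.1 (hk.trans_le (card_insert_le a S)))).trans_lt hadd
      · exact (haccept b List.mem_cons_self k hk).trans_le (ha b (by simp))
    · have hreject : ∀ i ∈ a :: l, y i ≤ t S.card :=
        List.forall_mem_cons.2 ⟨not_lt.1 hadd, fun i hi => (ha i hi).trans (not_lt.1 hadd)⟩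
      have hT := greedySelect_eq_self hreject
      exact ⟨[], a :: l, rfl, by simp [hT], by simp, by rwa [hT]⟩

end Greedy

namespace LinkSet

variable {n : ℕ} (L : LinkSet n) (T : Finset (Fin n))

/-- The signal strength, under geometric path-loss, of a link whose length is the minimum length in
`T`. It is the unit in which the powers received in a cluster are measured. -/
noncomputable def refGain (P α : ℝ) : ℝ := P / L.minLen T ^ α

theorem minLen_nonneg : 0 ≤ L.minLen T :=
  Real.sInf_nonneg (by rintro _ ⟨i, -, rfl⟩; exact dist_nonneg)

theorem refGain_nonneg {P : ℝ} (hP : 0 ≤ P) (α : ℝ) : 0 ≤ L.refGain T P α :=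
  div_nonneg hP (Real.rpow_nonneg (L.minLen_nonneg T) _)

end LinkSet

section ClusterSelect

open Finset

variable {n : ℕ} {L : LinkSet n} {P α β : ℝ} {x : Fin n → Fin n → ℝ} {C : Finset (Fin n)}
  {i j : Fin n}

theorem mem_byStrength : i ∈ byStrength x C ↔ i ∈ C := by
  simp only [byStrength, List.mem_insertionSort, mem_sort]

theorem pairwise_byStrength : (byStrength x C).Pairwise fun i j => x j j ≤ x i i :=
  have : Std.Total fun i j : Fin n => x j j ≤ x i i := ⟨fun _ _ => le_total _ _⟩
  have : IsTrans (Fin n) fun i j => x j j ≤ x i i := ⟨fun _ _ _ h h' => h'.trans h⟩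
  List.pairwise_insertionSort _ _

theorem exists_byStrength_eq_append (hβ : 0 ≤ β) (hP : 0 ≤ P) :
    ∃ l₁ l₂, byStrength x C = l₁ ++ l₂ ∧ clusterSelect L P α β x C = l₁.toFinset ∧
      (∀ i ∈ l₁, ∀ k < (clusterSelect L P α β x C).card,
        2 * β * (k : ℝ) * L.refGain C P α < x i i) ∧
      ∀ i ∈ l₂, x i i ≤ 2 * β * ((clusterSelect L P α β x C).card : ℝ) * L.refGain C P α := by
  have hmono : Monotone fun k : ℕ => 2 * β * (k : ℝ) * L.refGain C P α := fun k k' hk =>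
    mul_le_mul_of_nonneg_right (by gcongr) (L.refGain_nonneg C hP α)
  have hgreedy : clusterSelect L P α β x C = greedySelect
      (fun k : ℕ => 2 * β * (k : ℝ) * L.refGain C P α) (fun i => x i i) (byStrength x C) ∅ := rfl
  simpa only [hgreedy, empty_union] using
    exists_greedySelect_eq_prefix hmono (pairwise_byStrength (x := x) (C := C)) ∅

theorem clusterSelect_subset (hβ : 0 ≤ β) (hP : 0 ≤ P) : clusterSelect L P α β x C ⊆ C := by
  obtain ⟨l₁, l₂, hsplit, hT, -, -⟩ := exists_byStrength_eq_append (L := L) (α := α) (x := x)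
    (C := C) hβ hP
  intro i hi
  rw [hT, List.mem_toFinset] at hi
  exact mem_byStrength.1 (hsplit ▸ List.mem_append_left l₂ hi)

theorem lt_of_mem_clusterSelect (hβ : 0 ≤ β) (hP : 0 ≤ P) (hi : i ∈ clusterSelect L P α β x C)
    {k : ℕ} (hk : k < (clusterSelect L P α β x C).card) :
    2 * β * (k : ℝ) * L.refGain C P α < x i i := by
  obtain ⟨l₁, l₂, -, hT, haccept, -⟩ := exists_byStrength_eq_append (L := L) (α := α) (x := x)
    (C := C) hβ hP
  exact haccept i (List.mem_toFinset.1 (hT ▸ hi)) k hk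

theorem mem_clusterSelect_of_lt (hβ : 0 ≤ β) (hP : 0 ≤ P) (hi : i ∈ C)
    (hlt : 2 * β * ((clusterSelect L P α β x C).card : ℝ) * L.refGain C P α < x i i) :
    i ∈ clusterSelect L P α β x C := by
  obtain ⟨l₁, l₂, hsplit, hT, -, hreject⟩ := exists_byStrength_eq_append (L := L) (α := α) (x := x)
    (C := C) hβ hP
  rw [← mem_byStrength (x := x), hsplit, List.mem_append] at hi
  rw [hT, List.mem_toFinset]
  exact hi.resolve_right fun h => (hreject i h).not_gt hlt

theorem le_of_notMem_clusterSelect (hβ : 0 ≤ β) (hP : 0 ≤ P) (hi : i ∈ C)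
    (hi' : i ∉ clusterSelect L P α β x C) (hj : j ∈ clusterSelect L P α β x C) :
    x i i ≤ x j j := by
  obtain ⟨l₁, l₂, hsplit, hT, -, -⟩ := exists_byStrength_eq_append (L := L) (α := α) (x := x)
    (C := C) hβ hP
  have hsorted := pairwise_byStrength (x := x) (C := C)
  rw [hsplit, List.pairwise_append] at hsorted
  rw [← mem_byStrength (x := x), hsplit, List.mem_append] at hi
  rw [hT, List.mem_toFinset] at hi' hj
  exact hsorted.2.2 j hj i (hi.resolve_left hi')

theorem lt_card_clusterSelect (hβ : 0 ≤ β) (hP : 0 ≤ P) {r : ℕ}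
    (hr : r < #{i ∈ C | 2 * β * (r : ℝ) * L.refGain C P α < x i i}) :
    r < (clusterSelect L P α β x C).card := by
  by_contra! hle
  refine (hr.trans_le (card_le_card fun i hi => ?_)).not_ge hle
  obtain ⟨hiC, hi⟩ := mem_filter.1 hi
  refine mem_clusterSelect_of_lt hβ hP hiC (lt_of_le_of_lt ?_ hi)
  exact mul_le_mul_of_nonneg_right (by gcongr) (L.refGain_nonneg C hP α)

theorem pos_of_mem_clusterSelect (hβ : 0 ≤ β) (hP : 0 ≤ P) (hj : j ∈ clusterSelect L P α β x C) :
    0 < x j j := by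
  simpa using lt_of_mem_clusterSelect hβ hP hj (card_pos.2 ⟨j, hj⟩)

theorem clusterSelect_nonempty (hβ : 0 ≤ β) (hP : 0 ≤ P) (hi : i ∈ C) (hpos : 0 < x i i) :
    (clusterSelect L P α β x C).Nonempty :=
  card_pos.1 (lt_card_clusterSelect hβ hP
    (card_pos.2 ⟨i, mem_filter.2 ⟨hi, by simpa using hpos⟩⟩))

open Classical in
/-- The links selected in a cluster whose strength is proportional to the number of selected links,
with the factor `η` that makes their inverse strengths summable. A selected link can fail this only
if it is the only one. -/
noncomputable def goodSelect (L : LinkSet n) (P α β η : ℝ) (x : Fin n → Fin n → ℝ)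
    (C : Finset (Fin n)) : Finset (Fin n) :=
  {j ∈ clusterSelect L P α β x C |
    η * ((clusterSelect L P α β x C).card : ℝ) * L.refGain C P α ≤ x j j}

variable {η : ℝ}

theorem goodSelect_subset_clusterSelect : goodSelect L P α β η x C ⊆ clusterSelect L P α β x C :=
  filter_subset _ _

theorem goodSelect_eq_clusterSelect (hβ : 0 ≤ β) (hP : 0 ≤ P) (hη : η ≤ β)
    (hcard : 1 < (clusterSelect L P α β x C).card) :
    goodSelect L P α β η x C = clusterSelect L P α β x C := by
  refine filter_true_of_mem fun j hj => ?_
  obtain ⟨r, hr⟩ := Nat.exists_eq_add_of_lt hcard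
  have hlt : 2 * β * ((r + 1 : ℕ) : ℝ) * L.refGain C P α < x j j :=
    lt_of_mem_clusterSelect hβ hP hj (by omega)
  refine le_trans (mul_le_mul_of_nonneg_right ?_ (L.refGain_nonneg C hP α)) hlt.le
  rw [hr]
  push_cast
  nlinarith [mul_nonneg hβ (Nat.cast_nonneg (α := ℝ) r),
    mul_nonneg (sub_nonneg.2 hη) (Nat.cast_nonneg (α := ℝ) r)]

theorem card_clusterSelect_le (hβ : 0 ≤ β) (hP : 0 ≤ P) (hη : η ≤ β) :
    (clusterSelect L P α β x C).card ≤ (goodSelect L P α β η x C).card + 1 := by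
  by_cases hcard : 1 < (clusterSelect L P α β x C).card
  · rw [goodSelect_eq_clusterSelect hβ hP hη hcard]
    exact Nat.le_succ _
  · omega

theorem goodSelect_nonempty (hβ : 0 ≤ β) (hP : 0 ≤ P) (hη : η ≤ β) (hi : i ∈ C) (hpos : 0 < x i i)
    (hgood : η * L.refGain C P α ≤ x i i) : (goodSelect L P α β η x C).Nonempty := by
  have hne := clusterSelect_nonempty (L := L) (α := α) hβ hP hi hpos
  by_cases hcard : 1 < (clusterSelect L P α β x C).card
  · rwa [goodSelect_eq_clusterSelect hβ hP hη hcard]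
  obtain ⟨j, hj⟩ := card_eq_one.1 (le_antisymm (not_lt.1 hcard) (card_pos.2 hne))
  have hstrongest : x i i ≤ x j j := by
    by_cases hi' : i ∈ clusterSelect L P α β x C
    · rw [hj, mem_singleton] at hi'
      rw [hi']
    · exact le_of_notMem_clusterSelect hβ hP hi hi' (hj ▸ mem_singleton_self j)
  refine ⟨j, mem_filter.2 ⟨hj ▸ mem_singleton_self j, ?_⟩⟩
  rw [hj, card_singleton, Nat.cast_one, mul_one]
  exact hgood.trans hstrongest

end ClusterSelect

theorem abs_sub_le_dist (a b : Plane) (k : Fin 2) : |a k - b k| ≤ dist a b := by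
  rw [dist_eq_norm]
  exact PiLp.norm_apply_le (a - b) k

theorem dist_floor_div_le {h : ℝ} (hh : 0 < h) (a b c : ℝ) :
    (dist ⌊(a - c) / h⌋ ⌊(b - c) / h⌋ - 1) * h ≤ |a - b| := by
  have hfloor : dist ⌊(a - c) / h⌋ ⌊(b - c) / h⌋ ≤ |(a - c) / h - (b - c) / h| + 1 := by
    have ha := Int.floor_le ((a - c) / h)
    have ha' := Int.lt_floor_add_one ((a - c) / h)
    have hb := Int.floor_le ((b - c) / h)
    have hb' := Int.lt_floor_add_one ((b - c) / h)
    have hle := le_abs_self ((a - c) / h - (b - c) / h)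
    have hge := neg_abs_le ((a - c) / h - (b - c) / h)
    exact abs_le.2 ⟨by linarith, by linarith⟩
  rwa [← sub_div, sub_sub_sub_cancel_right, abs_div, abs_of_pos hh, ← sub_le_iff_le_add,
    le_div_iff₀ hh] at hfloor

theorem abs_sub_lt_of_floor_div_eq {a b c h : ℝ} (hh : 0 < h)
    (heq : ⌊(a - c) / h⌋ = ⌊(b - c) / h⌋) : |a - b| < h := by
  have hlt := Int.abs_sub_lt_one_of_floor_eq_floor heq
  rwa [← sub_div, sub_sub_sub_cancel_right, abs_div, abs_of_pos hh, div_lt_one hh] at hlt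

theorem sub_mem_Icc_of_floor_div_eq {a c h : ℝ} {z : ℤ} (hh : 0 < h)
    (heq : ⌊(a - c) / h⌋ = z) : a - (c + z * h) ∈ Set.Icc 0 h := by
  obtain ⟨hle, hlt⟩ := Int.floor_eq_iff.1 heq
  rw [le_div_iff₀ hh] at hle
  rw [div_lt_iff₀ hh] at hlt
  constructor <;> linarith

theorem nine_le_dist_of_intCast_eq {a b : ℤ} (h : (a : ZMod 9) = b) (hne : a ≠ b) :
    9 ≤ dist a b := by
  have hdvd : (9 : ℤ) ∣ a - b := (ZMod.intCast_eq_intCast_iff_dvd_sub b a 9).1 h.symm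
  rw [Int.dist_eq']
  exact_mod_cast Int.le_of_dvd (abs_pos.2 (sub_ne_zero.2 hne)) ((dvd_abs _ _).2 hdvd)

namespace LinkSet

open Finset

variable {n : ℕ} {L : LinkSet n} {T T' : Finset (Fin n)} {i j : Fin n}

theorem minLen_le (hi : i ∈ T) : L.minLen T ≤ L.len i :=
  csInf_le ⟨0, by rintro _ ⟨i, -, rfl⟩; exact dist_nonneg⟩ ⟨i, hi, rfl⟩

theorem exists_minLen_eq (hT : T.Nonempty) : ∃ i ∈ T, L.minLen T = L.len i := by
  obtain ⟨i, hi, h⟩ := (hT.to_set.image L.len).csInf_mem (T.finite_toSet.image _)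
  exact ⟨i, hi, h.symm⟩

theorem minLen_anti (h : T ⊆ T') (hT : T.Nonempty) : L.minLen T' ≤ L.minLen T := by
  obtain ⟨i, hi, heq⟩ := exists_minLen_eq (L := L) hT
  exact heq ▸ minLen_le (h hi)

theorem minLen_pos (hL : ∀ j i, L.sender j ≠ L.receiver i) (hT : T.Nonempty) :
    0 < L.minLen T := by
  obtain ⟨i, -, heq⟩ := exists_minLen_eq (L := L) hT
  exact heq ▸ dist_pos.2 (hL i i)

theorem Equilength.len_lt (h : L.Equilength T) (hi : i ∈ T) : L.len i < 2 * L.minLen T := by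
  obtain ⟨j, hj, heq⟩ := exists_minLen_eq (L := L) ⟨i, hi⟩
  exact heq ▸ h i hi j hj

theorem Equilength.mono (h : L.Equilength T') (hT : T ⊆ T') : L.Equilength T :=
  fun i hi j hj => h i (hT hi) j (hT hj)

section Clusters

variable {o : Plane} {q : ZMod 9 × ZMod 9} {C C' : Finset (Fin n)}

theorem mem_clusters : C ∈ L.clusters o q ↔
    ∃ i ∈ L.gridClass o q, {j ∈ L.gridClass o q | L.square o j = L.square o i} = C := by
  simp only [clusters, mem_image]

theorem subset_gridClass_of_mem_clusters (hC : C ∈ L.clusters o q) : C ⊆ L.gridClass o q := by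
  obtain ⟨i, -, rfl⟩ := mem_clusters.1 hC
  exact filter_subset _ _

theorem nonempty_of_mem_clusters (hC : C ∈ L.clusters o q) : C.Nonempty := by
  obtain ⟨i, hi, rfl⟩ := mem_clusters.1 hC
  exact ⟨i, mem_filter.2 ⟨hi, rfl⟩⟩

theorem square_eq_of_mem_clusters (hC : C ∈ L.clusters o q) (hi : i ∈ C) (hj : j ∈ C) :
    L.square o i = L.square o j := by
  obtain ⟨k, -, rfl⟩ := mem_clusters.1 hC
  exact (mem_filter.1 hi).2.trans (mem_filter.1 hj).2.symm

theorem eq_of_square_eq (hC : C ∈ L.clusters o q) (hC' : C' ∈ L.clusters o q) (hi : i ∈ C)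
    (hj : j ∈ C') (h : L.square o i = L.square o j) : C = C' := by
  obtain ⟨k, -, rfl⟩ := mem_clusters.1 hC
  obtain ⟨k', -, rfl⟩ := mem_clusters.1 hC'
  rw [← (mem_filter.1 hi).2, ← (mem_filter.1 hj).2, h]

theorem biUnion_clusters : (L.clusters o q).biUnion id = L.gridClass o q := by
  ext i
  refine ⟨fun hi => ?_, fun hi => mem_biUnion.2
    ⟨_, mem_clusters.2 ⟨i, hi, rfl⟩, mem_filter.2 ⟨hi, rfl⟩⟩⟩
  obtain ⟨C, hC, hiC⟩ := mem_biUnion.1 hi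
  exact subset_gridClass_of_mem_clusters hC hiC

theorem disjoint_clusters (hC : C ∈ L.clusters o q) (hC' : C' ∈ L.clusters o q) (h : C ≠ C') :
    Disjoint C C' :=
  disjoint_left.2 fun _ hi hi' => h (eq_of_square_eq hC hC' hi hi' rfl)

end Clusters

section Grid

variable {o : Plane} {q : ZMod 9 × ZMod 9}

theorem nine_le_dist_square (hi : i ∈ L.gridClass o q) (hj : j ∈ L.gridClass o q)
    (hne : L.square o i ≠ L.square o j) : 9 ≤ dist (L.square o i) (L.square o j) := by
  have hmod := (mem_filter.1 hi).2.trans (mem_filter.1 hj).2.symm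
  rw [Prod.dist_eq]
  by_cases hfst : (L.square o i).1 = (L.square o j).1
  · exact (nine_le_dist_of_intCast_eq (congrArg Prod.snd hmod) fun h => hne (Prod.ext hfst h)).trans
      (le_max_right _ _)
  · exact (nine_le_dist_of_intCast_eq (congrArg Prod.fst hmod) hfst).trans (le_max_left _ _)

variable (hL : ∀ j i, L.sender j ≠ L.receiver i)
include hL

theorem dist_square_sub_one_mul_le (o : Plane) (i j : Fin n) :
    (dist (L.square o i) (L.square o j) - 1) * (L.minLen univ / 2) ≤
      dist (L.sender i) (L.sender j) := by
  have hh : 0 < L.minLen univ / 2 := half_pos (minLen_pos hL ⟨i, mem_univ i⟩)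
  rw [← le_div_iff₀ hh, sub_le_iff_le_add, Prod.dist_eq]
  refine max_le ?_ ?_ <;> rw [← sub_le_iff_le_add, le_div_iff₀ hh]
  · exact (dist_floor_div_le hh _ _ _).trans (abs_sub_le_dist _ _ 0)
  · exact (dist_floor_div_le hh _ _ _).trans (abs_sub_le_dist _ _ 1)

theorem dist_sender_le (h : L.square o i = L.square o j) :
    dist (L.sender i) (L.sender j) ≤ 3 / 4 * L.minLen univ := by
  have hl : 0 < L.minLen univ := minLen_pos hL ⟨i, mem_univ i⟩
  have h₀ := abs_sub_lt_of_floor_div_eq (half_pos hl) (congrArg Prod.fst h)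
  have h₁ := abs_sub_lt_of_floor_div_eq (half_pos hl) (congrArg Prod.snd h)
  rw [EuclideanSpace.dist_eq, Fin.sum_univ_two, Real.dist_eq, Real.dist_eq]
  refine Real.sqrt_le_iff.2 ⟨by positivity, ?_⟩
  have hsq₀ := mul_self_le_mul_self (abs_nonneg _) h₀.le
  have hsq₁ := mul_self_le_mul_self (abs_nonneg _) h₁.le
  nlinarith

theorem isCluster_of_mem_clusters (hE : L.Equilength univ) {C : Finset (Fin n)}
    (hC : C ∈ L.clusters o q) : L.IsCluster C := by
  refine ⟨hE.mono (subset_univ _), ?_⟩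
  obtain ⟨i, hi⟩ := nonempty_of_mem_clusters hC
  let h := L.minLen univ / 2
  have hh : 0 < h := half_pos (minLen_pos hL ⟨i, mem_univ i⟩)
  have hside : h ≤ L.minLen C / 2 :=
    div_le_div_of_nonneg_right (minLen_anti (subset_univ _) ⟨i, hi⟩) zero_le_two
  refine ⟨!₂[o 0 + (L.square o i).1 * h, o 1 + (L.square o i).2 * h],
    EuclideanSpace.single 0 1, EuclideanSpace.single 1 1, by simp, by simp,
    by simp [EuclideanSpace.inner_single_left], fun j hj => ?_⟩
  have hsq := square_eq_of_mem_clusters hC hj hi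
  have h₀ := Set.Icc_subset_Icc_right hside
    (sub_mem_Icc_of_floor_div_eq hh (congrArg Prod.fst hsq))
  have h₁ := Set.Icc_subset_Icc_right hside
    (sub_mem_Icc_of_floor_div_eq hh (congrArg Prod.snd hsq))
  constructor
  · simpa [EuclideanSpace.inner_single_right] using h₀
  · simpa [EuclideanSpace.inner_single_right] using h₁

variable (hE : L.Equilength univ)
include hE

theorem two_mul_minLen_lt_dist (hi : i ∈ L.gridClass o q) (hj : j ∈ L.gridClass o q)
    (hne : L.square o i ≠ L.square o j) :
    2 * L.minLen univ < dist (L.sender i) (L.receiver j) := by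
  have hl : 0 < L.minLen univ := minLen_pos hL ⟨i, mem_univ i⟩
  have hlen : dist (L.receiver j) (L.sender j) < 2 * L.minLen univ :=
    dist_comm (L.sender j) _ ▸ hE.len_lt (mem_univ j)
  have htri := dist_triangle (L.sender i) (L.receiver j) (L.sender j)
  have hgrid := dist_square_sub_one_mul_le hL o i j
  nlinarith [nine_le_dist_square hi hj hne]

theorem one_add_dist_square_mul_le (hi : i ∈ L.gridClass o q) (hj : j ∈ L.gridClass o q) :
    (1 + dist (L.square o i) (L.square o j)) * (L.minLen univ / 8) ≤
      dist (L.sender i) (L.receiver j) := by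
  have hl : 0 < L.minLen univ := minLen_pos hL ⟨i, mem_univ i⟩
  by_cases hne : L.square o i = L.square o j
  · rw [hne, dist_self]
    have hnear := dist_sender_le hL hne
    have hlen : L.minLen univ ≤ dist (L.sender j) (L.receiver j) := minLen_le (mem_univ j)
    have htri := dist_triangle_left (L.sender j) (L.receiver j) (L.sender i)
    linarith
  · have hlen : dist (L.receiver j) (L.sender j) < 2 * L.minLen univ :=
      dist_comm (L.sender j) _ ▸ hE.len_lt (mem_univ j)
    have htri := dist_triangle (L.sender i) (L.receiver j) (L.sender j)
    have hgrid := dist_square_sub_one_mul_le hL o i j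
    nlinarith [nine_le_dist_square hi hj hne]

theorem isWellSeparated_gridClass (o : Plane) (q : ZMod 9 × ZMod 9) :
    L.IsWellSeparated (L.gridClass o q) (L.clusters o q) := by
  refine ⟨hE.mono (subset_univ _), biUnion_clusters,
    fun C hC => isCluster_of_mem_clusters hL hE hC, fun C hC C' hC' hne =>
    ⟨disjoint_clusters hC hC' hne, fun i hi j hj => ?_⟩⟩
  have hi' := subset_gridClass_of_mem_clusters hC hi
  have hj' := subset_gridClass_of_mem_clusters hC' hj
  have hsq : L.square o i ≠ L.square o j := fun h => hne (eq_of_square_eq hC hC' hi hj h)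
  have hlt : L.minLen (L.gridClass o q) < 2 * L.minLen univ :=
    (minLen_le hi').trans_lt (hE.len_lt (mem_univ i))
  exact lt_min (hlt.trans (two_mul_minLen_lt_dist hL hE hi' hj' hsq))
    (hlt.trans (two_mul_minLen_lt_dist hL hE hj' hi' hsq.symm))

theorem dist_le_of_mem_clusters {C : Finset (Fin n)} (hC : C ∈ L.clusters o q) (hi : i ∈ C)
    (hj : j ∈ C) : dist (L.sender i) (L.receiver j) ≤ 3 * L.minLen C :=
  calc dist (L.sender i) (L.receiver j)
      ≤ dist (L.sender i) (L.sender j) + L.len j := dist_triangle _ _ _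
    _ ≤ 3 / 4 * L.minLen univ + 2 * L.minLen C := add_le_add
        (dist_sender_le hL (square_eq_of_mem_clusters hC hi hj))
        ((hE.mono (subset_univ C)).len_lt hj).le
    _ ≤ 3 * L.minLen C := by
        linarith [minLen_anti (L := L) (subset_univ C) ⟨i, hi⟩, minLen_pos hL ⟨i, hi⟩]

end Grid

end LinkSet

theorem summable_one_add_norm_rpow {s : ℝ} (hs : 2 < s) :
    Summable fun z : ℤ × ℤ => (1 + ‖z‖) ^ (-s) := by
  have hsum : Summable fun z : ℤ × ℤ => ‖z‖ ^ (-s) := by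
    rw [← (finTwoArrowEquiv ℤ).summable_iff]
    refine (EisensteinSeries.summable_one_div_norm_rpow hs).congr fun z => ?_
    simp [Pi.norm_def, Fin.univ_succ, Prod.norm_def]
  refine hsum.of_norm_bounded_eventually ?_
  filter_upwards [(Set.finite_singleton (0 : ℤ × ℤ)).compl_mem_cofinite] with z hz
  rw [Real.norm_of_nonneg (by positivity)]
  exact Real.rpow_le_rpow_of_nonpos (norm_pos_iff.2 hz) (by linarith) (by linarith)

theorem exists_sum_one_add_dist_rpow_le {s : ℝ} (hs : 2 < s) : ∃ Z : ℝ, 0 < Z ∧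
    ∀ (F : Finset (ℤ × ℤ)) (w : ℤ × ℤ), ∑ z ∈ F, (1 + dist w z) ^ (-s) ≤ Z := by
  have hsum := summable_one_add_norm_rpow hs
  refine ⟨∑' z : ℤ × ℤ, (1 + ‖z‖) ^ (-s),
    hsum.tsum_pos (fun z => by positivity) 0 (by simp), fun F w => ?_⟩
  have hshift := hsum.sum_le_tsum (F.image fun z => w - z) fun z _ => by positivity
  simpa only [dist_eq_norm, Finset.sum_image sub_right_injective.injOn] using hshift

section Profile

open Finset

variable {n : ℕ}

open Classical in
/-- The maximum number of links in a feasible subset of `C`. -/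
noncomputable def optOn (β : ℝ) (x : Fin n → Fin n → ℝ) (C : Finset (Fin n)) : ℕ :=
  (univ.filter fun S : Finset (Fin n) => S ⊆ C ∧ IsFeasible β x S).sup card

/-- The outcomes of the finitely many comparisons of received powers on which the algorithm and the
optimum depend. A function of the received powers that factors through the profile is measurable. -/
def profile (L : LinkSet n) (P α β c η : ℝ) (x : Fin n → Fin n → ℝ) :
    (Fin n → Fin n → Prop) × (Finset (Fin n) → Finset (Fin n) → Fin n → Prop) ×
      (Finset (Fin n) → Finset (Fin n) → Fin n → Prop) × (Finset (Fin n) → Fin n → Prop) ×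
      (Finset (Fin n) → Prop) :=
  (fun i j => x j j ≤ x i i,
    fun T S i => 2 * β * (#S : ℝ) * L.refGain T P α < x i i,
    fun T S i => η * (#S : ℝ) * L.refGain T P α ≤ x i i,
    fun S j => affectance x S j < 2 * c,
    fun S => IsFeasible β x S)

variable {L : LinkSet n} {P α β c η : ℝ} {x x' : Fin n → Fin n → ℝ}

theorem profile_eq_iff : profile L P α β c η x = profile L P α β c η x' ↔
    (∀ i j, x j j ≤ x i i ↔ x' j j ≤ x' i i) ∧
    (∀ T S : Finset (Fin n), ∀ i, 2 * β * (#S : ℝ) * L.refGain T P α < x i i ↔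
      2 * β * (#S : ℝ) * L.refGain T P α < x' i i) ∧
    (∀ T S : Finset (Fin n), ∀ i, η * (#S : ℝ) * L.refGain T P α ≤ x i i ↔
      η * (#S : ℝ) * L.refGain T P α ≤ x' i i) ∧
    (∀ S j, affectance x S j < 2 * c ↔ affectance x' S j < 2 * c) ∧
    ∀ S, IsFeasible β x S ↔ IsFeasible β x' S := by
  simp only [profile, Prod.mk.injEq, funext_iff, eq_iff_iff]

theorem clusterSelect_congr (h : profile L P α β c η x = profile L P α β c η x') :
    clusterSelect L P α β x = clusterSelect L P α β x' := by
  obtain ⟨horder, hthreshold, -⟩ := profile_eq_iff.1 h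
  simp only [LinkSet.refGain] at hthreshold
  funext T
  simp only [clusterSelect, byStrength, horder, hthreshold]

theorem goodSelect_congr (h : profile L P α β c η x = profile L P α β c η x') :
    goodSelect L P α β η x = goodSelect L P α β η x' := by
  obtain ⟨-, -, hgood, -⟩ := profile_eq_iff.1 h
  funext T
  simp only [goodSelect, clusterSelect_congr h, hgood]

theorem isFeasible_congr (h : profile L P α β c η x = profile L P α β c η x') :
    IsFeasible β x = IsFeasible β x' := by
  obtain ⟨-, -, -, -, hfeas⟩ := profile_eq_iff.1 h
  exact funext fun S => propext (hfeas S)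

theorem selected_congr (h : profile L P α β c η x = profile L P α β c η x') (o : Plane) :
    selected L P α β o x = selected L P α β o x' := by
  funext q
  simp only [selected, clusterSelect_congr h]

theorem sparsified_congr (h : profile L P α β c η x = profile L P α β c η x') (o : Plane) :
    sparsified L P α β c o x = sparsified L P α β c o x' := by
  obtain ⟨-, -, -, haff, -⟩ := profile_eq_iff.1 h
  funext q
  simp only [sparsified, selected_congr h, haff]

theorem opt_congr (h : profile L P α β c η x = profile L P α β c η x') : opt β x = opt β x' := by
  rw [opt, isFeasible_congr h, opt]

theorem optOn_congr (h : profile L P α β c η x = profile L P α β c η x') :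
    optOn β x = optOn β x' := by
  funext C
  rw [optOn, isFeasible_congr h, optOn]

theorem isOutput_congr (h : profile L P α β c η x = profile L P α β c η x') (o : Plane) :
    IsOutput L P α β c o x = IsOutput L P α β c o x' := by
  funext A
  simp only [IsOutput, IsLargestFeasiblePart, sparsified_congr h, isFeasible_congr h]

variable {Ω : Type*} [MeasurableSpace Ω] {X : Fin n → Fin n → Ω → ℝ}

theorem measurable_affectance (hX : ∀ j i, Measurable (X j i)) (S : Finset (Fin n)) (j : Fin n) :
    Measurable fun ω => affectance (fun j i => X j i ω) S j :=
  Finset.measurable_fun_sum _ fun i _ => (hX i j).div (hX j j)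

theorem measurableSet_isFeasible (hX : ∀ j i, Measurable (X j i)) (S : Finset (Fin n)) :
    MeasurableSet {ω | IsFeasible β (fun j i => X j i ω) S} := by
  simp only [IsFeasible, Set.ofPred_forall]
  exact Finset.measurableSet_biInter _ fun i _ => measurableSet_lt
    ((Finset.measurable_fun_sum _ fun j _ => hX j i).const_mul β) (hX i i)

theorem measurable_profile (hX : ∀ j i, Measurable (X j i)) :
    Measurable fun ω => profile L P α β c η (fun j i => X j i ω) := by
  refine .prodMk ?_ (.prodMk ?_ (.prodMk ?_ (.prodMk ?_ ?_)))
  · exact measurable_pi_lambda _ fun i => measurable_pi_lambda _ fun j =>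
      measurableSet_setOfPred.1 (measurableSet_le (hX j j) (hX i i))
  · exact measurable_pi_lambda _ fun T => measurable_pi_lambda _ fun S => measurable_pi_lambda _
      fun i => measurableSet_setOfPred.1 (measurableSet_lt measurable_const (hX i i))
  · exact measurable_pi_lambda _ fun T => measurable_pi_lambda _ fun S => measurable_pi_lambda _
      fun i => measurableSet_setOfPred.1 (measurableSet_le measurable_const (hX i i))
  · exact measurable_pi_lambda _ fun S => measurable_pi_lambda _ fun j =>
      measurableSet_setOfPred.1 (measurableSet_lt (measurable_affectance hX S j) measurable_const)
  · exact measurable_pi_lambda _ fun S => measurableSet_setOfPred.1 (measurableSet_isFeasible hX S)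

theorem measurable_of_profile (L : LinkSet n) (P α β c η : ℝ) (hX : ∀ j i, Measurable (X j i))
    {γ : Type*} [MeasurableSpace γ] {F : (Fin n → Fin n → ℝ) → γ}
    (hF : ∀ x x', profile L P α β c η x = profile L P α β c η x' → F x = F x') :
    Measurable fun ω => F (fun j i => X j i ω) := by
  intro t _
  have hpreimage : (fun ω => F (fun j i => X j i ω)) ⁻¹' t =
      (fun ω => profile L P α β c η (fun j i => X j i ω)) ⁻¹'
        (profile L P α β c η '' (F ⁻¹' t)) := by
    ext ω
    refine ⟨fun h => ⟨_, h, rfl⟩, ?_⟩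
    rintro ⟨x, hxt, hx⟩
    rwa [Set.mem_preimage, ← hF _ _ hx]
  rw [hpreimage]
  exact measurable_profile hX (Set.toFinite _).measurableSet

end Profile

section Output

variable {n : ℕ} {L : LinkSet n} {P α β c : ℝ} {x : Fin n → Fin n → ℝ} {o : Plane}

theorem pos_of_mem_selected (hβ : 0 ≤ β) (hP : 0 ≤ P) {q : ZMod 9 × ZMod 9} {j : Fin n}
    (hj : j ∈ selected L P α β o x q) : 0 < x j j := by
  obtain ⟨C, -, hC⟩ := Finset.mem_biUnion.1 hj
  exact pos_of_mem_clusterSelect hβ hP hC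

theorem sparsified_subset_selected (q : ZMod 9 × ZMod 9) :
    sparsified L P α β c o x q ⊆ selected L P α β o x q :=
  Finset.filter_subset _ _

theorem exists_isOutput (hβ : 0 < β) (hc : 0 < c) (hP : 0 ≤ P) (hx : ∀ j i, 0 ≤ x j i) :
    ∃ A, IsOutput L P α β c o x A := by
  have hsolution : ∀ q, ∃ A,
      IsLargestFeasiblePart β x ⌈4 * c * β⌉₊ (sparsified L P α β c o x q) A := fun q =>
    exists_isLargestFeasiblePart hβ hc hx
      (fun j hj => pos_of_mem_selected hβ.le hP (sparsified_subset_selected q hj))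
      (fun j hj => (affectance_mono hx (sparsified_subset_selected q) j).trans_lt
        (Finset.mem_filter.1 hj).2)
  choose sol hsol using hsolution
  obtain ⟨q, hq⟩ := Finite.exists_max fun q => (sol q).card
  exact ⟨sol q, sol, hsol, ⟨q, rfl⟩, hq⟩

theorem IsOutput.isFeasible {A : Finset (Fin n)} (h : IsOutput L P α β c o x A) :
    IsFeasible β x A := by
  obtain ⟨sol, h, ⟨q, rfl⟩, -⟩ := h
  exact (h q).isFeasible

theorem IsOutput.sum_card_sparsified_le {A : Finset (Fin n)} (h : IsOutput L P α β c o x A) :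
    ∑ q, (sparsified L P α β c o x q).card ≤ 81 * ⌈4 * c * β⌉₊ * A.card := by
  obtain ⟨sol, h, -, hmax⟩ := h
  calc ∑ q, (sparsified L P α β c o x q).card
      ≤ ∑ _q : ZMod 9 × ZMod 9, ⌈4 * c * β⌉₊ * A.card :=
        Finset.sum_le_sum fun q _ => (h q).card_le.trans (Nat.mul_le_mul_left _ (hmax q))
    _ = 81 * ⌈4 * c * β⌉₊ * A.card := by
        rw [Finset.sum_const, Finset.card_univ, Fintype.card_prod, ZMod.card, smul_eq_mul]
        ring

variable {Ω : Type*} [MeasurableSpace Ω] {X : Fin n → Fin n → Ω → ℝ} {μ : Measure Ω}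

theorem exists_isRun (hX : ∀ j i, Measurable (X j i)) (h0 : ∀ᵐ ω ∂μ, ∀ j i, 0 ≤ X j i ω)
    (hβ : 0 < β) (hc : 0 < c) (hP : 0 ≤ P) : ∃ ALG, IsRun L P α β c o μ X ALG := by
  classical
  let F : (Fin n → Fin n → ℝ) → Finset (Fin n) := fun x =>
    if h : ∃ A, IsOutput L P α β c o x A then h.choose else ∅
  have hF : ∀ x x', profile L P α β c 0 x = profile L P α β c 0 x' → F x = F x' := fun x x' h => by
    simp only [F, isOutput_congr h o]
  refine ⟨fun ω => F fun j i => X j i ω, fun A => ?_, ?_⟩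
  · exact measurableSet_setOfPred.2 (measurable_of_profile L P α β c 0 hX (F := fun x => F x = A)
      fun x x' h => by rw [hF x x' h])
  · filter_upwards [h0] with ω hω
    have hex := exists_isOutput (L := L) (α := α) (o := o) hβ hc hP hω
    rw [show F (fun j i => X j i ω) = hex.choose from dif_pos hex]
    exact hex.choose_spec

end Output

section Chernoff

variable {Ω ι : Type*} [MeasurableSpace Ω] {μ : Measure Ω}

theorem iIndepSet_preimage {β : ι → Type*} [∀ i, MeasurableSpace (β i)] {Y : ∀ i, Ω → β i}
    (hind : iIndepFun Y μ) (hY : ∀ i, Measurable (Y i)) {B : ∀ i, Set (β i)}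
    (hB : ∀ i, MeasurableSet (B i)) : iIndepSet (fun i => Y i ⁻¹' B i) μ :=
  (iIndepSet_iff_meas_biInter fun i => hY i (hB i)).2 fun s =>
    iIndepFun_iff_measure_inter_preimage_eq_mul.1 hind s fun i _ => hB i

theorem mgf_indicator_one_neg_one_le [IsProbabilityMeasure μ] {E : Set Ω} (hE : MeasurableSet E) :
    mgf (E.indicator fun _ => 1) μ (-1) ≤ Real.exp (-(μ.real E / 2)) := by
  have hexp : Real.exp (-1) ≤ 1 / 2 := by
    rw [Real.exp_neg, ← one_div]
    exact one_div_le_one_div_of_le two_pos (by linarith [Real.add_one_le_exp (1 : ℝ)])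
  have haffine : (fun ω => Real.exp (-1 * E.indicator (fun _ => (1 : ℝ)) ω)) =
      fun ω => 1 - (1 - Real.exp (-1)) * E.indicator 1 ω := by
    funext ω
    by_cases h : ω ∈ E <;> simp [h]
  have hintegrable : Integrable (E.indicator (1 : Ω → ℝ)) μ :=
    (integrable_const (1 : ℝ)).indicator hE
  calc mgf (E.indicator fun _ => 1) μ (-1) = 1 - (1 - Real.exp (-1)) * μ.real E := by
        rw [mgf, haffine, integral_sub (integrable_const _) (hintegrable.const_mul _),
          integral_const_mul, integral_indicator_one hE, integral_const, probReal_univ, one_smul]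
    _ ≤ -(μ.real E / 2) + 1 := by nlinarith [measureReal_nonneg (μ := μ) (s := E)]
    _ ≤ Real.exp (-(μ.real E / 2)) := Real.add_one_le_exp _

open Classical Finset in
theorem measureReal_card_filter_le_le {E : ι → Set Ω} (hind : iIndepSet E μ)
    (hE : ∀ i, MeasurableSet (E i)) (s : Finset ι) {ν : ℝ} (hν : ν ≤ ∑ i ∈ s, μ.real (E i)) :
    μ.real {ω | (#{i ∈ s | ω ∈ E i} : ℝ) ≤ ν / 4} ≤ Real.exp (-(ν / 4)) := by
  have := hind.isProbabilityMeasure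
  let Z : ι → Ω → ℝ := fun i => (E i).indicator fun _ => 1
  have hZ : ∀ i, Measurable (Z i) := fun i => measurable_const.indicator (hE i)
  have hZind : iIndepFun Z μ := hind.iIndepFun_indicator
  have hcard : ∀ ω, (#{i ∈ s | ω ∈ E i} : ℝ) = (∑ i ∈ s, Z i) ω := fun ω => by
    simp [Z, Finset.sum_apply, Set.indicator_apply]
  have hintegrable : Integrable (fun ω => Real.exp (-1 * (∑ i ∈ s, Z i) ω)) μ := by
    refine hZind.integrable_exp_mul_sum hZ fun i _ => .of_bound (C := 1)
      (((hZ i).const_mul _).exp.aestronglyMeasurable) (.of_forall fun ω => ?_)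
    rw [Real.norm_eq_abs, Real.abs_exp, Real.exp_le_one_iff, neg_one_mul, neg_nonpos]
    exact Set.indicator_nonneg (fun _ _ => zero_le_one) ω
  simp_rw [hcard]
  calc μ.real {ω | (∑ i ∈ s, Z i) ω ≤ ν / 4}
      ≤ Real.exp (-(-1) * (ν / 4)) * ∏ i ∈ s, mgf (Z i) μ (-1) := by
        rw [← hZind.mgf_sum hZ]
        exact measure_le_le_exp_mul_mgf _ (by norm_num) hintegrable
    _ ≤ Real.exp (-(-1) * (ν / 4)) * ∏ i ∈ s, Real.exp (-(μ.real (E i) / 2)) := by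
        gcongr with i
        · exact fun i _ => mgf_nonneg
        · exact mgf_indicator_one_neg_one_le (hE i)
    _ ≤ Real.exp (-(ν / 4)) := by
        rw [← Real.exp_sum, sum_neg_distrib, ← sum_div, ← Real.exp_add, Real.exp_le_exp]
        linarith

theorem integrable_natCast_of_le [IsFiniteMeasure μ] {f : Ω → ℕ} (hf : Measurable f) {N : ℕ}
    (h : ∀ ω, f ω ≤ N) : Integrable (fun ω => (f ω : ℝ)) μ :=
  .of_bound (C := N) (measurable_from_top.comp hf).aestronglyMeasurable
    (.of_forall fun ω => by rw [Real.norm_natCast]; exact_mod_cast h ω)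

end Chernoff

namespace SSDistribution

variable {D : SSDistribution}

theorem IsSmooth.exists_le_tail {p : ℝ} (h : D.IsSmooth p) :
    ∃ c₀, 0 < c₀ ∧ ∀ m, 0 < m → p ≤ D.tail m c₀ := by
  obtain ⟨c₀, hc₀, hquantile⟩ := h
  refine ⟨c₀, hc₀, fun m hm => ?_⟩
  obtain ⟨x, rfl, hx⟩ := hquantile m hm
  have := D.isProbabilityMeasure m hm
  exact measureReal_mono (Set.Ioi_subset_Ioi hx)

theorem div_le_tail {m t : ℝ} (hm : 0 < m) {N : ℕ} (ht : 1 ≤ t) (h : t < D.g m N) :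
    t / N ≤ D.tail m t := by
  have := D.isProbabilityMeasure m hm
  have hsup := (lt_max_iff.1 h).resolve_left ht.not_gt
  have hne : {t : ℝ | 0 ≤ t ∧ D.tail m t ∈ Set.Icc (t / N) (2 * t / N)}.Nonempty := by
    by_contra! hempty
    rw [hempty, Real.sSup_empty] at hsup
    linarith
  obtain ⟨u, ⟨-, hu, -⟩, htu⟩ := exists_lt_of_lt_csSup hne hsup
  calc t / N ≤ u / N := by gcongr
    _ ≤ D.tail m u := hu
    _ ≤ D.tail m t := measureReal_mono (Set.Ioi_subset_Ioi (by gcongr))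

end SSDistribution

section Shadowing

variable {n : ℕ} {L : LinkSet n} {P α : ℝ}

theorem LinkSet.gain_pos (hL : ∀ j i, L.sender j ≠ L.receiver i) (hP : 0 < P) (j i : Fin n) :
    0 < L.gain P α j i :=
  div_pos hP (Real.rpow_pos_of_pos (dist_pos.2 (hL j i)) _)

variable {D : SSDistribution} {Ω : Type*} [MeasurableSpace Ω] {μ : Measure Ω}
  {X : Fin n → Fin n → Ω → ℝ}

namespace IsShadowing

theorem nonneg (h : IsShadowing D L P α μ X) (hL : ∀ j i, L.sender j ≠ L.receiver i)
    (hP : 0 < P) : ∀ᵐ ω ∂μ, ∀ j i, 0 ≤ X j i ω := by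
  refine ae_all_iff.2 fun j => ae_all_iff.2 fun i => ?_
  have hlaw := D.nonneg _ (L.gain_pos (α := α) hL hP j i)
  rw [← h.law j i] at hlaw
  exact ae_of_ae_map (h.measurable j i).aemeasurable hlaw

theorem integrable (h : IsShadowing D L P α μ X) (hL : ∀ j i, L.sender j ≠ L.receiver i)
    (hP : 0 < P) (j i : Fin n) : Integrable (X j i) μ := by
  have hlaw := D.integrable _ (L.gain_pos (α := α) hL hP j i)
  rw [← h.law j i] at hlaw
  exact (integrable_map_measure measurable_id.aestronglyMeasurable
    (h.measurable j i).aemeasurable).1 hlaw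

theorem integral_eq (h : IsShadowing D L P α μ X) (hL : ∀ j i, L.sender j ≠ L.receiver i)
    (hP : 0 < P) (j i : Fin n) : ∫ ω, X j i ω ∂μ = L.gain P α j i := by
  rw [← D.mean _ (L.gain_pos (α := α) hL hP j i), ← h.law j i,
    ← integral_map (f := fun x : ℝ => x) (h.measurable j i).aemeasurable aestronglyMeasurable_id]

theorem measureReal_preimage_Ioi (h : IsShadowing D L P α μ X) (j i : Fin n) (t : ℝ) :
    μ.real (X j i ⁻¹' Set.Ioi t) = (D.law (L.gain P α j i)).real (Set.Ioi t) := by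
  rw [← h.law j i, map_measureReal_apply (h.measurable j i) measurableSet_Ioi]

theorem le_measureReal_preimage_Ioi (h : IsShadowing D L P α μ X)
    (hL : ∀ j i, L.sender j ≠ L.receiver i) (hP : 0 < P) {p c₀ t : ℝ}
    (htail : ∀ m, 0 < m → p ≤ D.tail m c₀) {j i : Fin n} (ht : t ≤ c₀ * L.gain P α j i) :
    p ≤ μ.real (X j i ⁻¹' Set.Ioi t) := by
  have hgain := L.gain_pos (α := α) hL hP j i
  have := D.isProbabilityMeasure _ hgain
  rw [h.measureReal_preimage_Ioi]
  exact (htail _ hgain).trans (measureReal_mono (Set.Ioi_subset_Ioi ht))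

end IsShadowing

end Shadowing

section StrongPairs

open Finset

theorem sum_le_mul_card_filter_add {ι : Type*} {S : Finset ι} {f : ι → ℝ} {a m : ℝ} (ha : 0 ≤ a)
    (hf : ∀ i ∈ S, f i ≤ m) : ∑ i ∈ S, f i ≤ m * #{i ∈ S | a ≤ f i} + a * #S := by
  rw [← sum_filter_add_sum_filter_not S (a ≤ f ·)]
  have hlarge := sum_le_card_nsmul {i ∈ S | a ≤ f i} f m fun i hi => hf i (mem_filter.1 hi).1
  have hsmall := sum_le_card_nsmul {i ∈ S | ¬a ≤ f i} f a fun i hi =>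
    (not_le.1 (mem_filter.1 hi).2).le
  have hcard : (#{i ∈ S | ¬a ≤ f i} : ℝ) ≤ #S := by exact_mod_cast card_filter_le _ _
  rw [nsmul_eq_mul] at hlarge hsmall
  nlinarith

variable {n : ℕ} {L : LinkSet n} {P α β p τ δ t : ℝ} {x : Fin n → Fin n → ℝ}
  {C S : Finset (Fin n)}

/-- The ordered pairs of distinct links of `S` for which the interference of the first link on the
second exceeds `t`. -/
noncomputable def strongPairs (t : ℝ) (x : Fin n → Fin n → ℝ) (S : Finset (Fin n)) :
    Finset (Fin n × Fin n) :=
  {e ∈ S.offDiag | t < x e.1 e.2}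

theorem card_strongPairs : #(strongPairs t x S) = ∑ i ∈ S, #{j ∈ S.erase i | t < x j i} := by
  simp only [card_eq_sum_ones]
  refine sum_finset_product_right _ _ _ fun e => ?_
  simp only [strongPairs, mem_filter, mem_offDiag, mem_erase]
  tauto

theorem mul_card_lt_card_filter_of_lt_card_strongPairs (hp : 0 ≤ p) (hcard : 1 < #S)
    (hstrong : p * (#S * (#S - 1)) / 4 < #(strongPairs t x S)) :
    p * #S / 8 < #{i ∈ S | p * (#S - 1) / 8 ≤ #{j ∈ S.erase i | t < x j i}} := by
  have hcard' : (1 : ℝ) < #S := by exact_mod_cast hcard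
  have hle : ∀ i ∈ S, (#{j ∈ S.erase i | t < x j i} : ℝ) ≤ #S - 1 := fun i hi => by
    rw [← Nat.cast_pred (by omega), ← card_erase_of_mem hi, Nat.cast_le]
    exact card_filter_le _ _
  have hsum := sum_le_mul_card_filter_add (a := p * ((#S : ℝ) - 1) / 8)
    (div_nonneg (mul_nonneg hp (by linarith)) (by norm_num)) hle
  rw [card_strongPairs, Nat.cast_sum] at hstrong
  refine lt_of_mul_lt_mul_right ?_ (sub_pos.2 hcard').le
  linear_combination hstrong + hsum

theorem IsFeasible.mul_lt (hS : IsFeasible β x S) (hβ : 0 ≤ β) (hx : ∀ j i, 0 ≤ x j i)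
    {i : Fin n} (hi : i ∈ S) : β * (#{j ∈ S.erase i | t < x j i} * t) < x i i := by
  refine lt_of_le_of_lt (mul_le_mul_of_nonneg_left ?_ hβ) (hS i hi)
  calc #{j ∈ S.erase i | t < x j i} * t ≤ ∑ j ∈ S.erase i with t < x j i, x j i := by
        rw [← nsmul_eq_mul]
        exact card_nsmul_le_sum _ _ _ fun j hj => (mem_filter.1 hj).2.le
    _ ≤ ∑ j ∈ S.erase i, x j i :=
        sum_le_sum_of_subset_of_nonneg (filter_subset _ _) fun j _ _ => hx j i

/- Feasibility forces a link that suffers many strong interferences to have a large strength. If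
strong interferences are frequent, this concerns a constant fraction of the links of `S`, so the
greedy rule selects that many links. -/
theorem mul_card_le_card_clusterSelect (hβ : 0 ≤ β) (hP : 0 ≤ P) (hp : 0 ≤ p) (hτ : 0 ≤ τ)
    (hδ : 0 ≤ δ) (hδp : δ ≤ p / 8) (hδτ : δ ≤ τ * p / 32) (hx : ∀ j i, 0 ≤ x j i) (hSC : S ⊆ C)
    (hS : IsFeasible β x S) (hcard : 2 ≤ #S)
    (hstrong : p * (#S * (#S - 1)) / 4 < #(strongPairs (τ * L.refGain C P α) x S)) :
    δ * #S ≤ #(clusterSelect L P α β x C) := by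
  have hg := L.refGain_nonneg C hP α
  have hcard' : (2 : ℝ) ≤ #S := by exact_mod_cast hcard
  have hmany := mul_card_lt_card_filter_of_lt_card_strongPairs hp hcard hstrong
  set g := L.refGain C P α with hg_def
  have hfloor : (⌊δ * #S⌋₊ : ℝ) ≤ δ * #S := Nat.floor_le (by positivity)
  have hstrength : ∀ i ∈ S, p * ((#S : ℝ) - 1) / 8 ≤ #{j ∈ S.erase i | τ * g < x j i} →
      2 * β * (⌊δ * #S⌋₊ : ℝ) * g < x i i := fun i hi hcount =>
    calc 2 * β * (⌊δ * #S⌋₊ : ℝ) * g ≤ 2 * β * (τ * p / 32 * #S) * g := by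
          gcongr
          exact hfloor.trans (by gcongr)
      _ = β * (p * (#S / 2) / 8 * (τ * g)) := by ring
      _ ≤ β * (p * (#S - 1) / 8 * (τ * g)) := by
          gcongr
          linarith
      _ ≤ β * (#{j ∈ S.erase i | τ * g < x j i} * (τ * g)) := by gcongr
      _ < x i i := hS.mul_lt hβ hx hi
  have hselect : ⌊δ * #S⌋₊ < #(clusterSelect L P α β x C) := by
    refine lt_card_clusterSelect hβ hP ?_
    rw [← Nat.cast_lt (α := ℝ)]
    calc (⌊δ * #S⌋₊ : ℝ) ≤ p / 8 * #S := hfloor.trans (by gcongr)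
      _ = p * #S / 8 := by ring
      _ < _ := hmany
      _ ≤ _ := Nat.cast_le.2 (card_le_card fun i hi => by
          obtain ⟨hi, hcount⟩ := mem_filter.1 hi
          exact mem_filter.2 ⟨hSC hi, hstrength i hi hcount⟩)
  exact (Nat.lt_floor_add_one _).le.trans (by exact_mod_cast hselect)

theorem exists_isFeasible_card_eq_optOn : ∃ S ⊆ C, IsFeasible β x S ∧ optOn β x C = #S := by
  classical
  have hempty : IsFeasible β x (∅ : Finset (Fin n)) := by simp [IsFeasible]
  obtain ⟨S, hS, hopt⟩ := exists_mem_eq_sup (univ.filter fun S => S ⊆ C ∧ IsFeasible β x S)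
    ⟨∅, by simp [hempty]⟩ card
  obtain ⟨-, hSC, hS⟩ := mem_filter.1 hS
  exact ⟨S, hSC, hS, by rw [optOn, ← hopt]⟩

theorem optOn_le_card : optOn β x C ≤ #C := by
  obtain ⟨S, hSC, -, hopt⟩ := exists_isFeasible_card_eq_optOn (β := β) (x := x) (C := C)
  exact hopt.trans_le (card_le_card hSC)

theorem optOn_le_of_forall_lt_card_strongPairs (hβ : 0 ≤ β) (hP : 0 ≤ P) (hp : 0 ≤ p)
    (hτ : 0 ≤ τ) (hδ : 0 < δ) (hδp : δ ≤ p / 8) (hδτ : δ ≤ τ * p / 32) (hx : ∀ j i, 0 ≤ x j i)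
    {k : ℝ} (hk : 2 ≤ k) (hstrong : ∀ S ⊆ C, k ≤ #S →
      p * (#S * (#S - 1)) / 4 < #(strongPairs (τ * L.refGain C P α) x S)) :
    (optOn β x C : ℝ) ≤ #(clusterSelect L P α β x C) / δ + k := by
  obtain ⟨S, hSC, hS, hopt⟩ := exists_isFeasible_card_eq_optOn (β := β) (x := x) (C := C)
  have hdiv : (0 : ℝ) ≤ #(clusterSelect L P α β x C) / δ := by positivity
  rw [hopt]
  rcases lt_or_ge (#S : ℝ) k with hlt | hge
  · linarith
  · have hle := mul_card_le_card_clusterSelect hβ hP hp hτ hδ.le hδp hδτ hx hSC hS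
      (by exact_mod_cast hk.trans hge) (hstrong S hSC hge)
    have : (#S : ℝ) ≤ #(clusterSelect L P α β x C) / δ := by rwa [le_div_iff₀' hδ]
    linarith

end StrongPairs

namespace LinkSet

variable {n : ℕ} {L : LinkSet n} {P : ℝ} {T : Finset (Fin n)}

theorem refGain_pos (hL : ∀ j i, L.sender j ≠ L.receiver i) (hP : 0 < P) (hT : T.Nonempty)
    (α : ℝ) : 0 < L.refGain T P α :=
  div_pos hP (Real.rpow_pos_of_pos (minLen_pos hL hT) _)

theorem rpow_neg_mul_refGain_le_gain {α r : ℝ} {j i : Fin n} (hL : L.sender j ≠ L.receiver i)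
    (hP : 0 ≤ P) (hα : 0 ≤ α) (hr : 0 ≤ r)
    (hdist : dist (L.sender j) (L.receiver i) ≤ r * L.minLen T) :
    r ^ (-α) * L.refGain T P α ≤ L.gain P α j i := by
  have hle : dist (L.sender j) (L.receiver i) ^ α ≤ r ^ α * L.minLen T ^ α := by
    rw [← Real.mul_rpow hr (L.minLen_nonneg T)]
    gcongr
  calc r ^ (-α) * L.refGain T P α = P / (r ^ α * L.minLen T ^ α) := by
        rw [Real.rpow_neg hr, refGain, inv_mul_eq_div, div_div, mul_comm]
    _ ≤ L.gain P α j i :=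
        div_le_div_of_nonneg_left hP (Real.rpow_pos_of_pos (dist_pos.2 hL) _) hle

end LinkSet

section ExpectedOptimum

open Finset

theorem exp_neg_le_inv_mul_inv_pow {p N : ℝ} {k : ℕ} (hp : 0 < p) (hN : 1 ≤ N)
    (hk : 8 * Real.log N / p + 2 ≤ k) :
    Real.exp (-(p * (k * (k - 1)) / 4)) ≤ N⁻¹ * N⁻¹ ^ k := by
  have hN0 : 0 < N := zero_lt_one.trans_le hN
  have hlog := Real.log_nonneg hN
  have hk2 : (2 : ℝ) ≤ k := (le_add_of_nonneg_left (by positivity)).trans hk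
  have hpk : 8 * Real.log N ≤ (k - 1) * p := by
    rw [← div_le_iff₀ hp]
    linarith
  calc Real.exp (-(p * (k * (k - 1)) / 4)) ≤ Real.exp ((k + 1 : ℕ) * -Real.log N) := by
        rw [Real.exp_le_exp]
        push_cast
        nlinarith
    _ = N⁻¹ * N⁻¹ ^ k := by
        rw [Real.exp_nat_mul, Real.exp_neg, Real.exp_log hN0, pow_succ']

theorem card_mul_sum_exp_le {ι : Type*} {p : ℝ} (hp : 0 < p) {C : Finset ι} (hC : C.Nonempty) :
    (#C : ℝ) * ∑ S ∈ C.powerset with 8 * Real.log #C / p + 2 ≤ #S,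
      Real.exp (-(p * (#S * (#S - 1)) / 4)) ≤ 3 := by
  have hN : (1 : ℝ) ≤ #C := by exact_mod_cast hC.card_pos
  set N := (#C : ℝ)
  have hN0 : 0 < N := zero_lt_one.trans_le hN
  calc N * ∑ S ∈ C.powerset with 8 * Real.log N / p + 2 ≤ #S,
        Real.exp (-(p * (#S * (#S - 1)) / 4))
      ≤ N * ∑ S ∈ C.powerset, N⁻¹ * N⁻¹ ^ #S := by
        refine mul_le_mul_of_nonneg_left ?_ hN0.le
        refine (sum_le_sum fun S hS =>
          exp_neg_le_inv_mul_inv_pow hp hN (mem_filter.1 hS).2).trans ?_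
        exact sum_le_sum_of_subset_of_nonneg (filter_subset _ _) fun S _ _ => by positivity
    _ = (N⁻¹ + 1) ^ #C := by
        rw [← mul_sum, mul_inv_cancel_left₀ hN0.ne', ← sum_pow_mul_eq_add_pow]
        simp
    _ ≤ Real.exp N⁻¹ ^ #C := by gcongr; exact Real.add_one_le_exp _
    _ = Real.exp 1 := by rw [← Real.exp_nat_mul, mul_inv_cancel₀ hN0.ne']
    _ ≤ 3 := by linarith [Real.exp_one_lt_d9]

variable {n : ℕ} {L : LinkSet n} {P α β p c₀ t δ : ℝ} {o : Plane} {q : ZMod 9 × ZMod 9}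
  {C S : Finset (Fin n)} {Ω : Type*} {X : Fin n → Fin n → Ω → ℝ}

/-- The event that some set of at least `k` links of `C` has at most a quarter of the number of
pairs with interference above `t` that it would have in expectation if each pair had probability
`p`. -/
def fewStrongPairs (t p k : ℝ) (C : Finset (Fin n)) (X : Fin n → Fin n → Ω → ℝ) : Set Ω :=
  ⋃ S ∈ C.powerset.filter fun S => k ≤ #S,
    {ω | (#(strongPairs t (fun j i => X j i ω) S) : ℝ) ≤ p * (#S * (#S - 1)) / 4}

theorem optOn_le_add_indicator_fewStrongPairs {τ k : ℝ} (hβ : 0 ≤ β) (hP : 0 ≤ P) (hp : 0 ≤ p)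
    (hτ : 0 ≤ τ) (hδ : 0 < δ) (hδp : δ ≤ p / 8) (hδτ : δ ≤ τ * p / 32) (hk : 2 ≤ k) {ω : Ω}
    (hx : ∀ j i, 0 ≤ X j i ω) :
    (optOn β (fun j i => X j i ω) C : ℝ) ≤
      #(clusterSelect L P α β (fun j i => X j i ω) C) / δ + k +
        (fewStrongPairs (τ * L.refGain C P α) p k C X).indicator (fun _ => (#C : ℝ)) ω := by
  by_cases hω : ω ∈ fewStrongPairs (τ * L.refGain C P α) p k C X
  · rw [Set.indicator_of_mem hω]
    have : (optOn β (fun j i => X j i ω) C : ℝ) ≤ #C := by exact_mod_cast optOn_le_card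
    exact this.trans (le_add_of_nonneg_left (by positivity))
  · rw [Set.indicator_of_notMem hω, add_zero]
    simp only [fewStrongPairs, Set.mem_iUnion, not_exists, Set.mem_ofPred_eq, not_le] at hω
    exact optOn_le_of_forall_lt_card_strongPairs hβ hP hp hτ hδ hδp hδτ hx hk
      fun S hSC hS => hω S (mem_filter.2 ⟨mem_powerset.2 hSC, hS⟩)

variable [MeasurableSpace Ω] {μ : Measure Ω} {D : SSDistribution}

theorem measurable_card_clusterSelect (hX : ∀ j i, Measurable (X j i)) :
    Measurable fun ω => #(clusterSelect L P α β (fun j i => X j i ω) C) :=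
  measurable_of_profile L P α β 0 0 hX (F := fun x => #(clusterSelect L P α β x C))
    fun x x' h => by rw [clusterSelect_congr h]

theorem integrable_card_clusterSelect [IsFiniteMeasure μ] (hX : ∀ j i, Measurable (X j i)) :
    Integrable (fun ω => (#(clusterSelect L P α β (fun j i => X j i ω) C) : ℝ)) μ :=
  integrable_natCast_of_le (measurable_card_clusterSelect hX) fun _ => card_le_univ _

theorem integrable_optOn [IsFiniteMeasure μ] (hX : ∀ j i, Measurable (X j i)) :
    Integrable (fun ω => (optOn β (fun j i => X j i ω) C : ℝ)) μ :=
  integrable_natCast_of_le (measurable_of_profile ⟨0, 0⟩ 0 0 β 0 0 hX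
    (F := fun x => optOn β x C) fun _ _ h => by rw [optOn_congr h]) fun _ => optOn_le_card

theorem measurableSet_card_strongPairs_le (hX : ∀ j i, Measurable (X j i)) (a : ℝ) :
    MeasurableSet {ω | (#(strongPairs t (fun j i => X j i ω) S) : ℝ) ≤ a} := by
  refine measurableSet_le ?_ measurable_const
  simp only [strongPairs, card_filter, Nat.cast_sum, Nat.cast_ite, Nat.cast_one, Nat.cast_zero]
  exact Finset.measurable_fun_sum _ fun e _ => Measurable.ite
    (measurableSet_lt measurable_const (hX e.1 e.2)) measurable_const measurable_const

theorem measureReal_card_strongPairs_le_le (htail : ∀ m, 0 < m → p ≤ D.tail m c₀) (hP : 0 < P)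
    (hL : ∀ j i, L.sender j ≠ L.receiver i) (hX : IsShadowing D L P α μ X)
    (ht : ∀ i ∈ S, ∀ j ∈ S, t ≤ c₀ * L.gain P α j i) :
    μ.real {ω | (#(strongPairs t (fun j i => X j i ω) S) : ℝ) ≤ p * (#S * (#S - 1)) / 4} ≤
      Real.exp (-(p * (#S * (#S - 1)) / 4)) := by
  have hind := iIndepSet_preimage hX.indep (fun e => hX.measurable e.1 e.2)
    (B := fun _ => Set.Ioi t) fun _ => measurableSet_Ioi
  refine (measureReal_card_filter_le_le hind (fun e => hX.measurable e.1 e.2 measurableSet_Ioi)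
    S.offDiag ?_).trans_eq' ?_
  · have hle := card_nsmul_le_sum S.offDiag _ p fun e he => by
      obtain ⟨hj, hi, -⟩ := mem_offDiag.1 he
      exact hX.le_measureReal_preimage_Ioi hL hP htail (ht _ hi _ hj)
    refine hle.trans_eq' ?_
    rw [offDiag_card, nsmul_eq_mul, Nat.cast_sub (Nat.le_mul_self _)]
    push_cast
    ring
  · simp only [strongPairs, Set.mem_preimage, Set.mem_Ioi]

theorem measurableSet_fewStrongPairs (hX : ∀ j i, Measurable (X j i)) (k : ℝ) :
    MeasurableSet (fewStrongPairs t p k C X) :=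
  Finset.measurableSet_biUnion _ fun _ _ => measurableSet_card_strongPairs_le hX _

/- Large sets are so unlikely to have few strong interferences that a union bound over all of them
applies, even with the weight `#C`. -/
theorem card_mul_measureReal_fewStrongPairs_le (hp : 0 < p) (hC : C.Nonempty)
    (htail : ∀ m, 0 < m → p ≤ D.tail m c₀) (hP : 0 < P) (hL : ∀ j i, L.sender j ≠ L.receiver i)
    (hX : IsShadowing D L P α μ X) (ht : ∀ i ∈ C, ∀ j ∈ C, t ≤ c₀ * L.gain P α j i) :
    (#C : ℝ) * μ.real (fewStrongPairs t p (8 * Real.log #C / p + 2) C X) ≤ 3 := by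
  refine le_trans (mul_le_mul_of_nonneg_left ?_ (Nat.cast_nonneg _)) (card_mul_sum_exp_le hp hC)
  refine (measureReal_biUnion_finset_le _ _).trans (sum_le_sum fun S hS => ?_)
  have hSC := mem_powerset.1 (mem_filter.1 hS).1
  exact measureReal_card_strongPairs_le_le htail hP hL hX fun i hi j hj => ht i (hSC hi) j (hSC hj)

theorem integral_optOn_le [IsProbabilityMeasure μ] (hα : 0 ≤ α) (hβ : 0 ≤ β) (hp : 0 < p)
    (hc₀ : 0 ≤ c₀) (hδ : 0 < δ) (hδp : δ ≤ p / 8) (hδc₀ : δ ≤ c₀ * 3 ^ (-α) * p / 32)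
    (htail : ∀ m, 0 < m → p ≤ D.tail m c₀) (hP : 0 < P) (hL : ∀ j i, L.sender j ≠ L.receiver i)
    (hE : L.Equilength univ) (hC : C ∈ L.clusters o q) (hX : IsShadowing D L P α μ X) :
    ∫ ω, (optOn β (fun j i => X j i ω) C : ℝ) ∂μ ≤
      (∫ ω, (#(clusterSelect L P α β (fun j i => X j i ω) C) : ℝ) ∂μ) / δ +
        8 * Real.log #C / p + 5 := by
  have hCne := LinkSet.nonempty_of_mem_clusters hC
  set k : ℝ := 8 * Real.log #C / p + 2
  have hk : 2 ≤ k := le_add_of_nonneg_left (by positivity)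
  set t := c₀ * 3 ^ (-α) * L.refGain C P α with ht_def
  have ht : ∀ i ∈ C, ∀ j ∈ C, t ≤ c₀ * L.gain P α j i := fun i hi j hj => by
    rw [ht_def, mul_assoc]
    exact mul_le_mul_of_nonneg_left (LinkSet.rpow_neg_mul_refGain_le_gain (hL j i) hP.le hα
      (by norm_num) (LinkSet.dist_le_of_mem_clusters hL hE hC hj hi)) hc₀
  have hfew := measurableSet_fewStrongPairs (t := t) (p := p) (C := C) hX.measurable k
  have hselect := (integrable_card_clusterSelect (μ := μ) (L := L) (P := P) (α := α) (β := β)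
    (C := C) hX.measurable).div_const δ
  have hselect_add : Integrable (fun ω =>
      (#(clusterSelect L P α β (fun j i => X j i ω) C) : ℝ) / δ + k) μ :=
    hselect.add (integrable_const k)
  have hindicator := (integrable_const (μ := μ) (#C : ℝ)).indicator hfew
  calc ∫ ω, (optOn β (fun j i => X j i ω) C : ℝ) ∂μ
      ≤ ∫ ω, (#(clusterSelect L P α β (fun j i => X j i ω) C) / δ + k +
          (fewStrongPairs t p k C X).indicator (fun _ => (#C : ℝ)) ω) ∂μ := by
        refine integral_mono_ae (integrable_optOn hX.measurable)
          (hselect_add.add hindicator) ?_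
        filter_upwards [hX.nonneg hL hP] with ω hω
        exact optOn_le_add_indicator_fewStrongPairs hβ hP.le hp.le (by positivity) hδ hδp hδc₀ hk hω
    _ = (∫ ω, (#(clusterSelect L P α β (fun j i => X j i ω) C) : ℝ) ∂μ) / δ + k +
          #C * μ.real (fewStrongPairs t p k C X) := by
        rw [integral_add hselect_add hindicator,
          integral_add hselect (integrable_const k), integral_div,
          integral_indicator_const _ hfew, integral_const, probReal_univ, one_smul, smul_eq_mul,
          mul_comm (#C : ℝ)]
    _ ≤ _ := by
        have := card_mul_measureReal_fewStrongPairs_le hp hCne htail hP hL hX ht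
        linarith

end ExpectedOptimum

namespace LinkSet

theorem Equilength.rpow_neg_mul_refGain_le_gain {n : ℕ} {L : LinkSet n} {P α : ℝ}
    {T : Finset (Fin n)} (hE : L.Equilength T) (hL : ∀ j i, L.sender j ≠ L.receiver i)
    (hP : 0 ≤ P) (hα : 0 ≤ α) {i : Fin n} (hi : i ∈ T) :
    2 ^ (-α) * L.refGain T P α ≤ L.gain P α i i :=
  LinkSet.rpow_neg_mul_refGain_le_gain (hL i i) hP hα two_pos.le (hE.len_lt hi).le

end LinkSet

section ClusterExpectation

open Finset

variable {n : ℕ} {L : LinkSet n} {P α β η p c₀ δ s : ℝ} {C : Finset (Fin n)}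

theorem mul_le_card_clusterSelect {x : Fin n → Fin n → ℝ} (hβ : 0 ≤ β) (hP : 0 ≤ P) (hα : 0 ≤ α)
    (hδ : 0 ≤ δ) (hδ4 : δ ≤ 1 / 4) (hδα : 2 * β * δ ≤ 2 ^ (-α)) (hs : 0 ≤ s)
    (hL : ∀ j i, L.sender j ≠ L.receiver i) (hE : L.Equilength C)
    (hstrong : s / 4 < #{i ∈ C | s * L.gain P α i i < x i i}) :
    δ * s ≤ #(clusterSelect L P α β x C) := by
  have hfloor : (⌊δ * s⌋₊ : ℝ) ≤ δ * s := Nat.floor_le (by positivity)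
  have hstrength : ∀ i ∈ C, 2 * β * (⌊δ * s⌋₊ : ℝ) * L.refGain C P α ≤ s * L.gain P α i i :=
    fun i hi =>
      have hg := L.refGain_nonneg C hP α
      calc 2 * β * (⌊δ * s⌋₊ : ℝ) * L.refGain C P α ≤ 2 * β * (δ * s) * L.refGain C P α := by
            gcongr
        _ = 2 * β * δ * (s * L.refGain C P α) := by ring
        _ ≤ 2 ^ (-α) * (s * L.refGain C P α) := by gcongr
        _ = s * (2 ^ (-α) * L.refGain C P α) := by ring
        _ ≤ s * L.gain P α i i := by
            gcongr
            exact hE.rpow_neg_mul_refGain_le_gain hL hP hα hi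
  have hselect : ⌊δ * s⌋₊ < #(clusterSelect L P α β x C) := by
    refine lt_card_clusterSelect hβ hP ?_
    rw [← Nat.cast_lt (α := ℝ)]
    calc (⌊δ * s⌋₊ : ℝ) ≤ 1 / 4 * s := hfloor.trans (by gcongr)
      _ = s / 4 := by ring
      _ < _ := hstrong
      _ ≤ _ := Nat.cast_le.2 (card_le_card fun i hi => by
          obtain ⟨hi, hlt⟩ := mem_filter.1 hi
          exact mem_filter.2 ⟨hi, (hstrength i hi).trans_lt hlt⟩)
  exact (Nat.lt_floor_add_one _).le.trans (by exact_mod_cast hselect)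

variable {D : SSDistribution} {Ω : Type*} [MeasurableSpace Ω] {μ : Measure Ω}
  {X : Fin n → Fin n → Ω → ℝ}

theorem measureReal_card_filter_strength_le (hs : 0 < #C) (hs1 : 1 ≤ s)
    (hg : ∀ m, 0 < m → s < D.g m #C) (hP : 0 < P) (hL : ∀ j i, L.sender j ≠ L.receiver i)
    (hX : IsShadowing D L P α μ X) :
    μ.real {ω | (#{i ∈ C | s * L.gain P α i i < X i i ω} : ℝ) ≤ s / 4} ≤ Real.exp (-(s / 4)) := by
  have hind : iIndepFun (fun i => X i i) μ :=
    hX.indep.precomp (g := fun i : Fin n => (i, i)) fun _ _ h => congrArg Prod.fst h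
  have hsum : s ≤ ∑ i ∈ C, μ.real (X i i ⁻¹' Set.Ioi (s * L.gain P α i i)) :=
    calc s = ∑ _ ∈ C, s / #C := by
          rw [sum_const, nsmul_eq_mul, mul_div_cancel₀ _ (by positivity)]
      _ ≤ ∑ i ∈ C, μ.real (X i i ⁻¹' Set.Ioi (s * L.gain P α i i)) := by
          refine sum_le_sum fun i _ => ?_
          have hgain := L.gain_pos (α := α) hL hP i i
          rw [hX.measureReal_preimage_Ioi]
          exact SSDistribution.div_le_tail hgain hs1 (hg _ hgain)
  refine (measureReal_card_filter_le_le (iIndepSet_preimage hind (fun i => hX.measurable i i)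
    fun _ => measurableSet_Ioi) (fun i => hX.measurable i i measurableSet_Ioi) C hsum).trans_eq' ?_
  simp only [Set.mem_preimage, Set.mem_Ioi]

theorem measurable_card_goodSelect (hX : ∀ j i, Measurable (X j i)) :
    Measurable fun ω => #(goodSelect L P α β η (fun j i => X j i ω) C) :=
  measurable_of_profile L P α β 0 η hX (F := fun x => #(goodSelect L P α β η x C))
    fun x x' h => by rw [goodSelect_congr h]

theorem integrable_card_goodSelect [IsFiniteMeasure μ] (hX : ∀ j i, Measurable (X j i)) :
    Integrable (fun ω => (#(goodSelect L P α β η (fun j i => X j i ω) C) : ℝ)) μ :=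
  integrable_natCast_of_le (measurable_card_goodSelect hX) fun _ => card_le_univ _

variable [IsProbabilityMeasure μ]

theorem mul_le_two_mul_integral_card_clusterSelect (hβ : 0 ≤ β) (hα : 0 ≤ α) (hδ : 0 ≤ δ)
    (hδ4 : δ ≤ 1 / 4) (hδα : 2 * β * δ ≤ 2 ^ (-α)) (hC : 0 < #C) (hs : 4 ≤ s)
    (hg : ∀ m, 0 < m → s < D.g m #C) (hP : 0 < P) (hL : ∀ j i, L.sender j ≠ L.receiver i)
    (hE : L.Equilength C) (hX : IsShadowing D L P α μ X) :
    δ * s ≤ 2 * ∫ ω, (#(clusterSelect L P α β (fun j i => X j i ω) C) : ℝ) ∂μ := by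
  have hs0 : 0 ≤ s := by linarith
  let few : Set Ω := {ω | (#{i ∈ C | s * L.gain P α i i < X i i ω} : ℝ) ≤ s / 4}
  let many : Set Ω := {ω | δ * s ≤ #(clusterSelect L P α β (fun j i => X j i ω) C)}
  have hfew : μ.real few ≤ 1 / 2 :=
    calc μ.real few ≤ Real.exp (-(s / 4)) :=
          measureReal_card_filter_strength_le hC (by linarith) hg hP hL hX
      _ ≤ (s / 4 + 1)⁻¹ := by
          rw [Real.exp_neg]
          gcongr
          exact Real.add_one_le_exp _
      _ ≤ 1 / 2 := by
          rw [one_div]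
          gcongr
          linarith
  have hcover : few ∪ many = Set.univ := Set.eq_univ_of_forall fun ω => by
    by_cases hω : ω ∈ few
    · exact .inl hω
    · exact .inr (mul_le_card_clusterSelect hβ hP.le hα hδ hδ4 hδα hs0 hL hE (not_le.1 hω))
  have hmany : 1 / 2 ≤ μ.real many := by
    have := measureReal_union_le (μ := μ) few many
    rw [hcover, probReal_univ] at this
    linarith
  have hmarkov := mul_meas_ge_le_integral_of_nonneg (.of_forall fun ω => Nat.cast_nonneg _)
    (integrable_card_clusterSelect (μ := μ) (L := L) (P := P) (α := α) (β := β) (C := C)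
      hX.measurable) (δ * s)
  have : δ * s * (1 / 2) ≤ δ * s * μ.real many := by gcongr
  linarith

theorem log_card_le {κ : ℝ} {N : ℕ} (hβ : 0 ≤ β) (hα : 0 ≤ α) (hδ : 0 < δ) (hδ4 : δ ≤ 1 / 4)
    (hδα : 2 * β * δ ≤ 2 ^ (-α)) (hκ : 0 < κ)
    (hg : ∀ k ≥ N, ∀ m, 0 < m → κ * Real.log k ≤ D.g m k) (hP : 0 < P)
    (hL : ∀ j i, L.sender j ≠ L.receiver i) (hE : L.Equilength C) (hC : C.Nonempty)
    (hX : IsShadowing D L P α μ X) :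
    Real.log #C ≤ Real.log N + 2 / κ *
      (2 / δ * ∫ ω, (#(clusterSelect L P α β (fun j i => X j i ω) C) : ℝ) ∂μ + 4) := by
  rcases lt_or_ge #C N with hlt | hge
  · have hlog : Real.log #C ≤ Real.log N :=
      Real.log_le_log (by exact_mod_cast hC.card_pos) (by exact_mod_cast hlt.le)
    exact hlog.trans (le_add_of_nonneg_right (by positivity))
  refine le_add_of_nonneg_of_le (Real.log_natCast_nonneg _) ?_
  rw [← div_le_iff₀' (by positivity), div_div_eq_mul_div]
  rcases lt_or_ge (Real.log #C * κ / 2) 4 with hsmall | hlarge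
  · exact hsmall.le.trans (le_add_of_nonneg_left (by positivity))
  · have := mul_le_two_mul_integral_card_clusterSelect hβ hα hδ.le hδ4 hδα hC.card_pos hlarge
      (fun m hm => (by linarith : Real.log #C * κ / 2 < κ * Real.log #C).trans_le (hg _ hge m hm))
      hP hL hE hX
    refine le_add_of_le_of_nonneg ?_ (by norm_num)
    rwa [div_mul_eq_mul_div, le_div_iff₀' hδ]

theorem le_integral_card_goodSelect (hα : 0 ≤ α) (hβ : 0 ≤ β) (hc₀ : 0 < c₀) (hη : η ≤ β)
    (hηc₀ : η ≤ c₀ * 2 ^ (-α)) (htail : ∀ m, 0 < m → p ≤ D.tail m c₀) (hP : 0 < P)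
    (hL : ∀ j i, L.sender j ≠ L.receiver i) (hE : L.Equilength C) (hC : C.Nonempty)
    (hX : IsShadowing D L P α μ X) :
    p ≤ ∫ ω, (#(goodSelect L P α β η (fun j i => X j i ω) C) : ℝ) ∂μ := by
  obtain ⟨i, hi⟩ := hC
  have hgain := L.gain_pos (α := α) hL hP i i
  have hstrong : X i i ⁻¹' Set.Ioi (c₀ * L.gain P α i i) ⊆
      {ω | 1 ≤ (#(goodSelect L P α β η (fun j i => X j i ω) C) : ℝ)} := fun ω hω => by
    have hω : c₀ * L.gain P α i i < X i i ω := hω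
    have hgood : η * L.refGain C P α ≤ X i i ω :=
      calc η * L.refGain C P α ≤ c₀ * 2 ^ (-α) * L.refGain C P α :=
            mul_le_mul_of_nonneg_right hηc₀ (L.refGain_nonneg C hP.le α)
        _ = c₀ * (2 ^ (-α) * L.refGain C P α) := mul_assoc _ _ _
        _ ≤ c₀ * L.gain P α i i := by
            gcongr
            exact hE.rpow_neg_mul_refGain_le_gain hL hP.le hα hi
        _ ≤ X i i ω := hω.le
    have hne := goodSelect_nonempty (x := fun j i => X j i ω) hβ hP.le hη hi
      ((mul_pos hc₀ hgain).trans hω) hgood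
    exact_mod_cast hne.card_pos
  calc p ≤ μ.real (X i i ⁻¹' Set.Ioi (c₀ * L.gain P α i i)) :=
        hX.le_measureReal_preimage_Ioi hL hP htail le_rfl
    _ ≤ μ.real {ω | 1 ≤ (#(goodSelect L P α β η (fun j i => X j i ω) C) : ℝ)} :=
        measureReal_mono hstrong
    _ ≤ ∫ ω, (#(goodSelect L P α β η (fun j i => X j i ω) C) : ℝ) ∂μ := by
        simpa using mul_meas_ge_le_integral_of_nonneg (.of_forall fun ω => Nat.cast_nonneg _)
          (integrable_card_goodSelect (μ := μ) hX.measurable) 1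

theorem integral_card_clusterSelect_le (hα : 0 ≤ α) (hβ : 0 ≤ β) (hp : 0 < p) (hc₀ : 0 < c₀)
    (hη : η ≤ β) (hηc₀ : η ≤ c₀ * 2 ^ (-α)) (htail : ∀ m, 0 < m → p ≤ D.tail m c₀) (hP : 0 < P)
    (hL : ∀ j i, L.sender j ≠ L.receiver i) (hE : L.Equilength C) (hC : C.Nonempty)
    (hX : IsShadowing D L P α μ X) :
    ∫ ω, (#(clusterSelect L P α β (fun j i => X j i ω) C) : ℝ) ∂μ ≤
      (1 + 1 / p) * ∫ ω, (#(goodSelect L P α β η (fun j i => X j i ω) C) : ℝ) ∂μ := by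
  have hgood := integrable_card_goodSelect (μ := μ) (L := L) (P := P) (α := α) (β := β) (η := η)
    (C := C) hX.measurable
  have hle := le_integral_card_goodSelect hα hβ hc₀ hη hηc₀ htail hP hL hE hC hX
  calc ∫ ω, (#(clusterSelect L P α β (fun j i => X j i ω) C) : ℝ) ∂μ
      ≤ ∫ ω, ((#(goodSelect L P α β η (fun j i => X j i ω) C) : ℝ) + 1) ∂μ :=
        integral_mono (integrable_card_clusterSelect hX.measurable)
          (hgood.add (integrable_const 1)) fun ω =>
            (Nat.cast_le.2 (card_clusterSelect_le hβ hP.le hη)).trans_eq (Nat.cast_succ _)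
    _ = ∫ ω, (#(goodSelect L P α β η (fun j i => X j i ω) C) : ℝ) ∂μ + 1 := by
        rw [integral_add hgood (integrable_const 1), integral_const, probReal_univ, one_smul]
    _ ≤ _ := by
        rw [one_add_mul, one_div_mul_eq_div]
        gcongr
        rwa [one_le_div hp]

end ClusterExpectation

section ExpectedOptimum

open Finset

/- In expectation, a cluster optimum exceeds a multiple of the greedy selection only by a logarithm
of the size of the cluster, and the growth of `D.g` makes the greedy selection at least that
large. -/
theorem exists_integral_optOn_le {α β p c₀ η : ℝ} (hα : 0 ≤ α) (hβ : 0 < β) (hp : 0 < p)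
    (hc₀ : 0 < c₀) (hη : η ≤ β) (hηc₀ : η ≤ c₀ * 2 ^ (-α)) {D : SSDistribution}
    (htail : ∀ m, 0 < m → p ≤ D.tail m c₀) (hg : D.HasLogGrowth) :
    ∃ K : ℝ, 0 < K ∧ ∀ (n : ℕ) (L : LinkSet n) (P : ℝ), 0 < P →
      (∀ j i, L.sender j ≠ L.receiver i) → L.Equilength univ →
      ∀ (o : Plane) (q : ZMod 9 × ZMod 9), ∀ C ∈ L.clusters o q,
      ∀ {Ω : Type*} [MeasurableSpace Ω] (μ : Measure Ω) [IsProbabilityMeasure μ]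
        (X : Fin n → Fin n → Ω → ℝ), IsShadowing D L P α μ X →
        ∫ ω, (optOn β (fun j i => X j i ω) C : ℝ) ∂μ ≤
          K * ∫ ω, (#(goodSelect L P α β η (fun j i => X j i ω) C) : ℝ) ∂μ := by
  obtain ⟨κ, hκ, N, hN⟩ := hg
  let δ₁ := min (p / 8) (c₀ * 3 ^ (-α) * p / 32)
  have hδ₁ : 0 < δ₁ := lt_min (by positivity) (by positivity)
  let δ₂ := min (1 / 4) (2 ^ (-α) / (2 * β))
  have hδ₂ : 0 < δ₂ := lt_min (by positivity) (by positivity)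
  have hδ₂α : 2 * β * δ₂ ≤ 2 ^ (-α) := (le_div_iff₀' (by positivity)).1 (min_le_right _ _)
  let a := 1 / δ₁ + 8 / p * (2 / κ * (2 / δ₂))
  let b := 8 / p * (Real.log N + 2 / κ * 4) + 5
  have hb : 0 < b := by positivity
  refine ⟨a * (1 + 1 / p) + b / p, by positivity, fun n L P hP hL hE o q C hC Ω _ μ _ X hX => ?_⟩
  have hCne := LinkSet.nonempty_of_mem_clusters hC
  have hCE : L.Equilength C := hE.mono (subset_univ _)
  have hopt := integral_optOn_le hα hβ.le hp hc₀.le hδ₁ (min_le_left _ _) (min_le_right _ _) htail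
    hP hL hE hC hX
  have hlog := log_card_le hβ.le hα hδ₂ (min_le_left _ _) hδ₂α hκ hN hP hL hCE hCne hX
  have hselect := integral_card_clusterSelect_le hα hβ.le hp hc₀ hη hηc₀ htail hP hL hCE hCne hX
  have hgood := le_integral_card_goodSelect hα hβ.le hc₀ hη hηc₀ htail hP hL hCE hCne hX
  set E := ∫ ω, (#(clusterSelect L P α β (fun j i => X j i ω) C) : ℝ) ∂μ
  set G := ∫ ω, (#(goodSelect L P α β η (fun j i => X j i ω) C) : ℝ) ∂μ
  calc ∫ ω, (optOn β (fun j i => X j i ω) C : ℝ) ∂μ ≤ E / δ₁ + 8 * Real.log #C / p + 5 := hopt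
    _ ≤ E / δ₁ + 8 * (Real.log N + 2 / κ * (2 / δ₂ * E + 4)) / p + 5 := by gcongr
    _ = a * E + b := by ring
    _ ≤ a * ((1 + 1 / p) * G) + b * (G / p) := by
        gcongr
        exact le_mul_of_one_le_right hb.le ((one_le_div hp).2 hgood)
    _ = (a * (1 + 1 / p) + b / p) * G := by ring

end ExpectedOptimum

section Affectance

open Finset

variable {n : ℕ} {L : LinkSet n} {P α β η K Z : ℝ} {o : Plane} {q : ZMod 9 × ZMod 9}
  {x x' : Fin n → Fin n → ℝ} {C : Finset (Fin n)}

theorem LinkSet.gain_le_mul_refGain (hα : 0 ≤ α) (hP : 0 ≤ P)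
    (hL : ∀ j i, L.sender j ≠ L.receiver i) (hE : L.Equilength univ) (hC : C ∈ L.clusters o q)
    {i j : Fin n} (hi : i ∈ L.gridClass o q) (hj : j ∈ C) :
    L.gain P α i j ≤
      16 ^ α * (1 + dist (L.square o i) (L.square o j)) ^ (-α) * L.refGain C P α := by
  have hmin : 0 < L.minLen C := minLen_pos hL ⟨j, hj⟩
  set w := 1 + dist (L.square o i) (L.square o j)
  have hw : 0 < w := by positivity
  have hle : w * L.minLen C / 16 ≤ dist (L.sender i) (L.receiver j) :=
    calc w * L.minLen C / 16 ≤ w * (2 * L.minLen univ) / 16 := by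
          gcongr
          exact (minLen_le hj).trans (hE.len_lt (mem_univ j)).le
      _ = w * (L.minLen univ / 8) := by ring
      _ ≤ dist (L.sender i) (L.receiver j) :=
          one_add_dist_square_mul_le hL hE hi (subset_gridClass_of_mem_clusters hC hj)
  calc L.gain P α i j ≤ P / (w * L.minLen C / 16) ^ α :=
        div_le_div_of_nonneg_left hP (by positivity) (Real.rpow_le_rpow (by positivity) hle hα)
    _ = 16 ^ α * w ^ (-α) * L.refGain C P α := by
        rw [Real.div_rpow (by positivity) (by norm_num), Real.mul_rpow hw.le hmin.le,
          Real.rpow_neg hw.le, LinkSet.refGain]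
        field_simp

theorem pairwiseDisjoint_goodSelect (hβ : 0 ≤ β) (hP : 0 ≤ P) :
    (L.clusters o q : Set (Finset (Fin n))).PairwiseDisjoint (goodSelect L P α β η x) :=
  have hsub (C : Finset (Fin n)) : goodSelect L P α β η x C ⊆ C :=
    goodSelect_subset_clusterSelect.trans (clusterSelect_subset hβ hP)
  fun _ hC _ hC' hne => (LinkSet.disjoint_clusters hC hC' hne).mono (hsub _) (hsub _)

theorem sum_goodSelect_gain_div_le (hα : 0 ≤ α) (hβ : 0 ≤ β) (hη : 0 < η) (hP : 0 < P)
    (hL : ∀ j i, L.sender j ≠ L.receiver i) (hE : L.Equilength univ) (hC : C ∈ L.clusters o q)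
    {i : Fin n} (hi : i ∈ L.gridClass o q) {z : ℤ × ℤ} (hz : ∀ j ∈ C, L.square o j = z) :
    ∑ j ∈ goodSelect L P α β η x C, L.gain P α i j / x j j ≤
      16 ^ α / η * (1 + dist (L.square o i) z) ^ (-α) := by
  have hg := LinkSet.refGain_pos hL hP (LinkSet.nonempty_of_mem_clusters hC) α
  set w := (1 + dist (L.square o i) z) ^ (-α)
  set k := #(clusterSelect L P α β x C)
  have hterm : ∀ j ∈ goodSelect L P α β η x C, L.gain P α i j / x j j ≤ 16 ^ α / η * w / k := by
    intro j hj
    obtain ⟨hsel, hstrength⟩ := mem_filter.1 hj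
    have hk : 0 < k := card_pos.2 ⟨j, hsel⟩
    have hjC := clusterSelect_subset hβ hP.le hsel
    have hgain := LinkSet.gain_le_mul_refGain hα hP.le hL hE hC hi hjC
    rw [hz j hjC] at hgain
    calc L.gain P α i j / x j j ≤ 16 ^ α * w * L.refGain C P α / (η * k * L.refGain C P α) := by
          gcongr
      _ = 16 ^ α / η * w / k := by field_simp
  refine (sum_le_card_nsmul _ _ _ hterm).trans ?_
  have hcard : (#(goodSelect L P α β η x C) : ℝ) ≤ k := by
    exact_mod_cast card_le_card goodSelect_subset_clusterSelect
  rw [nsmul_eq_mul, mul_div_assoc', mul_comm]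
  exact div_le_of_le_mul₀ (Nat.cast_nonneg _) (by positivity) (by gcongr)

/-- The links that survive the strength requirement of `goodSelect` in the clusters of a grid class;
the affectance on these links is controlled in expectation. -/
noncomputable def goodSelected (L : LinkSet n) (P α β η : ℝ) (o : Plane) (x : Fin n → Fin n → ℝ)
    (q : ZMod 9 × ZMod 9) : Finset (Fin n) :=
  (L.clusters o q).biUnion (goodSelect L P α β η x)

theorem sum_goodSelected_gain_div_le (hα : 0 ≤ α) (hβ : 0 ≤ β) (hη : 0 < η) (hP : 0 < P)
    (hL : ∀ j i, L.sender j ≠ L.receiver i) (hE : L.Equilength univ)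
    (hZ : ∀ (F : Finset (ℤ × ℤ)) w, ∑ z ∈ F, (1 + dist w z) ^ (-α) ≤ Z) {i : Fin n}
    (hi : i ∈ L.gridClass o q) :
    ∑ j ∈ goodSelected L P α β η o x q, L.gain P α i j / x j j ≤ 16 ^ α / η * Z := by
  have hsquare : ∀ C ∈ L.clusters o q, ∃ z, ∀ j ∈ C, L.square o j = z := fun C hC =>
    have ⟨k, hk⟩ := LinkSet.nonempty_of_mem_clusters hC
    ⟨L.square o k, fun j hj => LinkSet.square_eq_of_mem_clusters hC hj hk⟩
  choose! z hz using hsquare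
  have hinj : Set.InjOn z (L.clusters o q) := fun C hC C' hC' h => by
    obtain ⟨k, hk⟩ := LinkSet.nonempty_of_mem_clusters hC
    obtain ⟨k', hk'⟩ := LinkSet.nonempty_of_mem_clusters hC'
    exact LinkSet.eq_of_square_eq hC hC' hk hk' (by rw [hz C hC k hk, hz C' hC' k' hk', h])
  calc ∑ j ∈ goodSelected L P α β η o x q, L.gain P α i j / x j j
      = ∑ C ∈ L.clusters o q, ∑ j ∈ goodSelect L P α β η x C, L.gain P α i j / x j j :=
        sum_biUnion (pairwiseDisjoint_goodSelect hβ hP.le)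
    _ ≤ ∑ C ∈ L.clusters o q, 16 ^ α / η * (1 + dist (L.square o i) (z C)) ^ (-α) :=
        sum_le_sum fun C hC => sum_goodSelect_gain_div_le hα hβ hη hP hL hE hC hi (hz C hC)
    _ = 16 ^ α / η * ∑ y ∈ (L.clusters o q).image z, (1 + dist (L.square o i) y) ^ (-α) := by
        rw [← mul_sum, sum_image hinj]
    _ ≤ 16 ^ α / η * Z := by
        gcongr
        exact hZ _ _

end Affectance

section Selected

open Finset

variable {n : ℕ} {L : LinkSet n} {P α β η : ℝ} {o : Plane} {q : ZMod 9 × ZMod 9}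
  {x x' : Fin n → Fin n → ℝ}

theorem goodSelected_subset_selected :
    goodSelected L P α β η o x q ⊆ selected L P α β o x q :=
  biUnion_mono fun _ _ => goodSelect_subset_clusterSelect

theorem selected_subset_gridClass (hβ : 0 ≤ β) (hP : 0 ≤ P) :
    selected L P α β o x q ⊆ L.gridClass o q :=
  biUnion_subset.2 fun _ hC =>
    (clusterSelect_subset hβ hP).trans (LinkSet.subset_gridClass_of_mem_clusters hC)

theorem card_selected_le :
    #(selected L P α β o x q) ≤ ∑ C ∈ L.clusters o q, #(clusterSelect L P α β x C) :=
  card_biUnion_le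

theorem card_goodSelected (hβ : 0 ≤ β) (hP : 0 ≤ P) :
    #(goodSelected L P α β η o x q) = ∑ C ∈ L.clusters o q, #(goodSelect L P α β η x C) :=
  card_biUnion (pairwiseDisjoint_goodSelect hβ hP)

theorem goodSelected_congr {c : ℝ} (h : profile L P α β c η x = profile L P α β c η x') :
    goodSelected L P α β η o x = goodSelected L P α β η o x' := by
  funext q
  rw [goodSelected, goodSelected, goodSelect_congr h]

theorem clusterSelect_congr_diag (h : ∀ i, x i i = x' i i) :
    clusterSelect L P α β x = clusterSelect L P α β x' := by
  funext C
  simp only [clusterSelect, byStrength, h]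

theorem selected_congr_diag (h : ∀ i, x i i = x' i i) :
    selected L P α β o x = selected L P α β o x' := by
  funext q
  rw [selected, selected, clusterSelect_congr_diag h]

theorem goodSelected_congr_diag (h : ∀ i, x i i = x' i i) :
    goodSelected L P α β η o x = goodSelected L P α β η o x' := by
  have hgood : goodSelect L P α β η x = goodSelect L P α β η x' := by
    funext C
    simp only [goodSelect, clusterSelect_congr_diag h, h]
  funext q
  rw [goodSelected, goodSelected, hgood]

end Selected

section SelectWeight

open Finset

variable {n : ℕ} {L : LinkSet n} {P α β η K : ℝ} {o : Plane} {q : ZMod 9 × ZMod 9}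
  {x x' : Fin n → Fin n → ℝ} {i j : Fin n}

open Classical in
/-- The inverse strength of link `j` if `i` is selected and `j` is a good selected link, and `0`
otherwise. This is the part of the affectance of `i` on `j` that is determined by the signal
strengths alone. -/
noncomputable def selectWeight (L : LinkSet n) (P α β η : ℝ) (o : Plane) (q : ZMod 9 × ZMod 9)
    (x : Fin n → Fin n → ℝ) (i j : Fin n) : ℝ :=
  if i ∈ selected L P α β o x q ∧ j ∈ goodSelected L P α β η o x q then (x j j)⁻¹ else 0

theorem selectWeight_congr_diag (h : ∀ i, x i i = x' i i) :
    selectWeight L P α β η o q x = selectWeight L P α β η o q x' := by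
  funext i j
  simp only [selectWeight, selected_congr_diag h, goodSelected_congr_diag h, h]

theorem selectWeight_nonneg (hβ : 0 ≤ β) (hP : 0 ≤ P) (i j : Fin n) :
    0 ≤ selectWeight L P α β η o q x i j := by
  unfold selectWeight
  split_ifs with h
  · exact inv_nonneg.2 (pos_of_mem_selected hβ hP (goodSelected_subset_selected h.2)).le
  · exact le_rfl

theorem sum_offDiag_selectWeight_mul (y : Fin n → Fin n → ℝ) :
    ∑ e ∈ univ.offDiag, selectWeight L P α β η o q x e.1 e.2 * y e.1 e.2 =
      ∑ j ∈ goodSelected L P α β η o x q, ∑ i ∈ (selected L P α β o x q).erase j,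
        y i j / x j j := by
  classical
  simp only [selectWeight, ite_mul, zero_mul, ← sum_filter, inv_mul_eq_div]
  refine sum_finset_product_right _ _ _ fun e => ?_
  simp only [mem_filter, mem_offDiag, mem_univ, true_and, mem_erase]
  tauto

theorem sum_affectance_eq :
    ∑ j ∈ goodSelected L P α β η o x q, affectance x (selected L P α β o x q) j =
      ∑ e ∈ univ.offDiag, selectWeight L P α β η o q x e.1 e.2 * x e.1 e.2 :=
  (sum_offDiag_selectWeight_mul x).symm

theorem sum_selectWeight_mul_gain_le (hβ : 0 ≤ β) (hP : 0 < P)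
    (hL : ∀ j i, L.sender j ≠ L.receiver i)
    (hK : ∀ i ∈ L.gridClass o q, ∑ j ∈ goodSelected L P α β η o x q, L.gain P α i j / x j j ≤ K) :
    ∑ e ∈ univ.offDiag, selectWeight L P α β η o q x e.1 e.2 * L.gain P α e.1 e.2 ≤
      K * #(selected L P α β o x q) := by
  have hterm (i : Fin n) {j : Fin n} (hj : j ∈ goodSelected L P α β η o x q) :
      0 ≤ L.gain P α i j / x j j :=
    div_nonneg (L.gain_pos hL hP i j).le
      (pos_of_mem_selected hβ hP.le (goodSelected_subset_selected hj)).le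
  calc ∑ e ∈ univ.offDiag, selectWeight L P α β η o q x e.1 e.2 * L.gain P α e.1 e.2
      = ∑ j ∈ goodSelected L P α β η o x q, ∑ i ∈ (selected L P α β o x q).erase j,
          L.gain P α i j / x j j := sum_offDiag_selectWeight_mul _
    _ ≤ ∑ j ∈ goodSelected L P α β η o x q, ∑ i ∈ selected L P α β o x q,
          L.gain P α i j / x j j :=
        sum_le_sum fun j hj =>
          sum_le_sum_of_subset_of_nonneg (erase_subset _ _) fun i _ _ => hterm i hj
    _ = ∑ i ∈ selected L P α β o x q, ∑ j ∈ goodSelected L P α β η o x q,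
          L.gain P α i j / x j j := sum_comm
    _ ≤ #(selected L P α β o x q) • K :=
        sum_le_card_nsmul _ _ _ fun i hi => hK i (selected_subset_gridClass hβ hP.le hi)
    _ = K * #(selected L P α β o x q) := by rw [nsmul_eq_mul, mul_comm]

theorem selectWeight_le_div_gain (hβ : 0 ≤ β) (hP : 0 < P)
    (hL : ∀ j i, L.sender j ≠ L.receiver i) (hK₀ : 0 ≤ K)
    (hK : ∀ i ∈ L.gridClass o q, ∑ j ∈ goodSelected L P α β η o x q, L.gain P α i j / x j j ≤ K) :
    selectWeight L P α β η o q x i j ≤ K / L.gain P α i j := by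
  have hgain := L.gain_pos (α := α) hL hP
  unfold selectWeight
  split_ifs with h
  · rw [le_div_iff₀ (hgain i j), inv_mul_eq_div]
    refine le_trans ?_ (hK i (selected_subset_gridClass hβ hP.le h.1))
    exact single_le_sum (f := fun j => L.gain P α i j / x j j) (fun k hk =>
      div_nonneg (hgain i k).le
        (pos_of_mem_selected hβ hP.le (goodSelected_subset_selected hk)).le) h.2
  · exact div_nonneg hK₀ (hgain i j).le

variable {D : SSDistribution} {Ω : Type*} [MeasurableSpace Ω] {μ : Measure Ω}
  {X : Fin n → Fin n → Ω → ℝ}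

theorem measurable_selectWeight (hX : ∀ j i, Measurable (X j i)) (i j : Fin n) :
    Measurable fun ω => selectWeight L P α β η o q (fun j i => X j i ω) i j := by
  classical
  have hmem := measurable_of_profile L P α β 0 η hX
    (F := fun x => i ∈ selected L P α β o x q ∧ j ∈ goodSelected L P α β η o x q)
    fun x x' h => by rw [selected_congr h, goodSelected_congr h]
  exact Measurable.ite (measurableSet_setOfPred.2 hmem) (hX j j).inv measurable_const

theorem indepFun_selectWeight (hX : IsShadowing D L P α μ X) (hij : i ≠ j) :
    IndepFun (fun ω => selectWeight L P α β η o q (fun j i => X j i ω) i j) (X i j) μ := by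
  let S : Finset (Fin n × Fin n) := univ.diag
  have hmem (a : Fin n) : (a, a) ∈ S := mem_diag.2 ⟨mem_univ a, rfl⟩
  have hdisj : Disjoint S {(i, j)} :=
    disjoint_singleton_right.2 fun h => hij (mem_diag.1 h).2
  have hindep := hX.indep.indepFun_finset S {(i, j)} hdisj fun e => hX.measurable e.1 e.2
  let signal (a b : Fin n) (y : S → ℝ) : ℝ := if a = b then y ⟨(a, a), hmem a⟩ else 0
  have hsignal (a b : Fin n) : Measurable (signal a b) := by
    unfold signal
    split_ifs
    exacts [measurable_pi_apply _, measurable_const]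
  refine (hindep.comp (measurable_selectWeight (L := L) (P := P) (α := α) (β := β) (η := η)
    (o := o) (q := q) hsignal i j)
    (measurable_pi_apply ⟨(i, j), mem_singleton_self _⟩)).congr (.of_forall fun ω => ?_)
    (.of_forall fun ω => rfl)
  exact congrFun₂ (selectWeight_congr_diag fun a => by simp [signal]) i j

variable [IsFiniteMeasure μ]

theorem integrable_selectWeight (hβ : 0 ≤ β) (hP : 0 < P)
    (hL : ∀ j i, L.sender j ≠ L.receiver i) (hK₀ : 0 ≤ K)
    (hK : ∀ x, ∀ i ∈ L.gridClass o q,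
      ∑ j ∈ goodSelected L P α β η o x q, L.gain P α i j / x j j ≤ K)
    (hX : ∀ j i, Measurable (X j i)) (i j : Fin n) :
    Integrable (fun ω => selectWeight L P α β η o q (fun j i => X j i ω) i j) μ :=
  .of_bound (measurable_selectWeight hX i j).aestronglyMeasurable (K / L.gain P α i j)
    (.of_forall fun _ => by
      rw [Real.norm_of_nonneg (selectWeight_nonneg hβ hP.le i j)]
      exact selectWeight_le_div_gain hβ hP hL hK₀ (hK _))

theorem integrable_selectWeight_mul (hβ : 0 ≤ β) (hP : 0 < P)
    (hL : ∀ j i, L.sender j ≠ L.receiver i) (hK₀ : 0 ≤ K)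
    (hK : ∀ x, ∀ i ∈ L.gridClass o q,
      ∑ j ∈ goodSelected L P α β η o x q, L.gain P α i j / x j j ≤ K)
    (hX : IsShadowing D L P α μ X) (hij : i ≠ j) :
    Integrable (fun ω => selectWeight L P α β η o q (fun j i => X j i ω) i j * X i j ω) μ :=
  (indepFun_selectWeight hX hij).integrable_mul
    (integrable_selectWeight hβ hP hL hK₀ hK hX.measurable i j) (hX.integrable hL hP i j)

theorem integrable_card_selected (hX : ∀ j i, Measurable (X j i)) :
    Integrable (fun ω => (#(selected L P α β o (fun j i => X j i ω) q) : ℝ)) μ :=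
  integrable_natCast_of_le (N := n) (measurable_of_profile L P α β 0 0 hX
    (F := fun x => #(selected L P α β o x q)) fun x x' h => by rw [selected_congr h])
    fun _ => card_finset_fin_le _

theorem integrable_sum_affectance (hβ : 0 ≤ β) (hP : 0 < P)
    (hL : ∀ j i, L.sender j ≠ L.receiver i) (hK₀ : 0 ≤ K)
    (hK : ∀ x, ∀ i ∈ L.gridClass o q,
      ∑ j ∈ goodSelected L P α β η o x q, L.gain P α i j / x j j ≤ K)
    (hX : IsShadowing D L P α μ X) :
    Integrable (fun ω => ∑ j ∈ goodSelected L P α β η o (fun j i => X j i ω) q,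
      affectance (fun j i => X j i ω) (selected L P α β o (fun j i => X j i ω) q) j) μ := by
  simp only [sum_affectance_eq]
  exact integrable_finsetSum _ fun e he =>
    integrable_selectWeight_mul hβ hP hL hK₀ hK hX (mem_offDiag.1 he).2.2

/- The selected sets depend only on the signal strengths, hence are independent of every
interference: in expectation the latter may be replaced by its mean. -/
theorem integral_sum_affectance_le (hβ : 0 ≤ β) (hP : 0 < P)
    (hL : ∀ j i, L.sender j ≠ L.receiver i) (hK₀ : 0 ≤ K)
    (hK : ∀ x, ∀ i ∈ L.gridClass o q,
      ∑ j ∈ goodSelected L P α β η o x q, L.gain P α i j / x j j ≤ K)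
    (hX : IsShadowing D L P α μ X) :
    ∫ ω, ∑ j ∈ goodSelected L P α β η o (fun j i => X j i ω) q,
        affectance (fun j i => X j i ω) (selected L P α β o (fun j i => X j i ω) q) j ∂μ ≤
      K * ∫ ω, (#(selected L P α β o (fun j i => X j i ω) q) : ℝ) ∂μ := by
  set w := fun ω => selectWeight L P α β η o q (fun j i => X j i ω)
  have hw (i j : Fin n) : Integrable (fun ω => w ω i j * L.gain P α i j) μ :=
    (integrable_selectWeight hβ hP hL hK₀ hK hX.measurable i j).mul_const _
  have hmean {i j : Fin n} (hij : i ≠ j) :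
      ∫ ω, w ω i j * X i j ω ∂μ = ∫ ω, w ω i j * L.gain P α i j ∂μ := by
    rw [integral_mul_const, ← hX.integral_eq hL hP i j]
    exact (indepFun_selectWeight hX hij).integral_fun_mul_eq_mul_integral
      (measurable_selectWeight hX.measurable i j).aestronglyMeasurable
      (hX.measurable i j).aestronglyMeasurable
  simp only [sum_affectance_eq]
  calc ∫ ω, ∑ e ∈ univ.offDiag, w ω e.1 e.2 * X e.1 e.2 ω ∂μ
      = ∑ e ∈ univ.offDiag, ∫ ω, w ω e.1 e.2 * X e.1 e.2 ω ∂μ :=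
        integral_finsetSum _ fun e he =>
          integrable_selectWeight_mul hβ hP hL hK₀ hK hX (mem_offDiag.1 he).2.2
    _ = ∑ e ∈ univ.offDiag, ∫ ω, w ω e.1 e.2 * L.gain P α e.1 e.2 ∂μ :=
        sum_congr rfl fun e he => hmean (mem_offDiag.1 he).2.2
    _ = ∫ ω, ∑ e ∈ univ.offDiag, w ω e.1 e.2 * L.gain P α e.1 e.2 ∂μ :=
        (integral_finsetSum _ fun e _ => hw e.1 e.2).symm
    _ ≤ ∫ ω, K * (#(selected L P α β o (fun j i => X j i ω) q) : ℝ) ∂μ :=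
        integral_mono (integrable_finsetSum _ fun e _ => hw e.1 e.2)
          ((integrable_card_selected hX.measurable).const_mul K)
          fun ω => sum_selectWeight_mul_gain_le hβ hP hL (hK _)
    _ = K * ∫ ω, (#(selected L P α β o (fun j i => X j i ω) q) : ℝ) ∂μ :=
        integral_const_mul K _

end SelectWeight

section Expectation

open Finset

variable {n : ℕ} {L : LinkSet n} {P α β η c p c₀ K : ℝ} {o : Plane} {q : ZMod 9 × ZMod 9}
  {x : Fin n → Fin n → ℝ}

theorem IsFeasible.card_le_optOn {S C : Finset (Fin n)} (h : IsFeasible β x S) (hSC : S ⊆ C) :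
    #S ≤ optOn β x C := by
  classical
  exact le_sup (f := card) (mem_filter.2 ⟨mem_univ S, hSC, h⟩)

theorem opt_le_sum_optOn (L : LinkSet n) (o : Plane) (hβ : 0 ≤ β) (hx : ∀ j i, 0 ≤ x j i) :
    opt β x ≤ ∑ q, ∑ C ∈ L.clusters o q, optOn β x C := by
  classical
  refine Finset.sup_le fun S hS => ?_
  have hfeas : IsFeasible β x S := (mem_filter.1 hS).2
  have hcover : S ⊆ univ.biUnion fun q => (L.clusters o q).biUnion fun C => S ∩ C := by
    intro i hi
    have hiq : i ∈ L.gridClass o (((L.square o i).1 : ZMod 9), ((L.square o i).2 : ZMod 9)) :=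
      mem_filter.2 ⟨mem_univ i, rfl⟩
    rw [← LinkSet.biUnion_clusters] at hiq
    obtain ⟨C, hC, hiC⟩ := mem_biUnion.1 hiq
    exact mem_biUnion.2 ⟨_, mem_univ _, mem_biUnion.2 ⟨C, hC, mem_inter.2 ⟨hi, hiC⟩⟩⟩
  calc #S ≤ #(univ.biUnion fun q => (L.clusters o q).biUnion fun C => S ∩ C) := card_le_card hcover
    _ ≤ ∑ q, ∑ C ∈ L.clusters o q, #(S ∩ C) :=
        card_biUnion_le.trans (sum_le_sum fun q _ => card_biUnion_le)
    _ ≤ ∑ q, ∑ C ∈ L.clusters o q, optOn β x C :=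
        sum_le_sum fun q _ => sum_le_sum fun C _ =>
          (hfeas.mono hβ hx inter_subset_left).card_le_optOn inter_subset_right

theorem card_goodSelected_le (hc : 0 < c) (hx : ∀ j i, 0 ≤ x j i) :
    (#(goodSelected L P α β η o x q) : ℝ) ≤ #(sparsified L P α β c o x q) +
      (∑ j ∈ goodSelected L P α β η o x q, affectance x (selected L P α β o x q) j) / (2 * c) := by
  classical
  set G := goodSelected L P α β η o x q
  set a := affectance x (selected L P α β o x q)
  have hlow : {j ∈ G | a j < 2 * c} ⊆ sparsified L P α β c o x q := fun j hj =>
    have ⟨hjG, hja⟩ := mem_filter.1 hj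
    mem_filter.2 ⟨goodSelected_subset_selected hjG, hja⟩
  have hhigh : (#{j ∈ G | ¬ a j < 2 * c} : ℝ) ≤ (∑ j ∈ G, a j) / (2 * c) := by
    rw [le_div_iff₀ (by positivity), ← nsmul_eq_mul]
    exact (card_nsmul_le_sum _ a _ fun j hj => not_lt.1 (mem_filter.1 hj).2).trans
      (sum_le_sum_of_subset_of_nonneg (filter_subset _ _) fun j _ _ => affectance_nonneg hx _ j)
  calc (#G : ℝ) = #{j ∈ G | a j < 2 * c} + #{j ∈ G | ¬ a j < 2 * c} := by
        exact_mod_cast (card_filter_add_card_filter_not _).symm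
    _ ≤ #(sparsified L P α β c o x q) + (∑ j ∈ G, a j) / (2 * c) :=
        add_le_add (Nat.cast_le.2 (card_le_card hlow)) hhigh

variable {D : SSDistribution} {Ω : Type*} [MeasurableSpace Ω] {μ : Measure Ω}
  {X : Fin n → Fin n → Ω → ℝ}

section IsFiniteMeasure

variable [IsFiniteMeasure μ]

theorem integrable_card_sparsified (hX : ∀ j i, Measurable (X j i)) :
    Integrable (fun ω => (#(sparsified L P α β c o (fun j i => X j i ω) q) : ℝ)) μ :=
  integrable_natCast_of_le (N := n) (measurable_of_profile L P α β c 0 hX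
    (F := fun x => #(sparsified L P α β c o x q)) fun x x' h => by rw [sparsified_congr h])
    fun _ => card_finset_fin_le _

theorem integrable_opt (hX : ∀ j i, Measurable (X j i)) :
    Integrable (fun ω => (opt β (fun j i => X j i ω) : ℝ)) μ :=
  integrable_natCast_of_le (measurable_of_profile ⟨0, 0⟩ 0 0 β 0 0 hX
    (F := opt β) fun _ _ h => opt_congr h) fun _ => opt_le _ _

theorem integrable_card_goodSelected (hX : ∀ j i, Measurable (X j i)) :
    Integrable (fun ω => (#(goodSelected L P α β η o (fun j i => X j i ω) q) : ℝ)) μ :=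
  integrable_natCast_of_le (N := n) (measurable_of_profile L P α β 0 η hX
    (F := fun x => #(goodSelected L P α β η o x q)) fun x x' h => by rw [goodSelected_congr h])
    fun _ => card_finset_fin_le _

theorem integral_card_goodSelected (hβ : 0 ≤ β) (hP : 0 ≤ P) (hX : ∀ j i, Measurable (X j i)) :
    ∫ ω, (#(goodSelected L P α β η o (fun j i => X j i ω) q) : ℝ) ∂μ =
      ∑ C ∈ L.clusters o q, ∫ ω, (#(goodSelect L P α β η (fun j i => X j i ω) C) : ℝ) ∂μ := by
  simp only [card_goodSelected hβ hP, Nat.cast_sum]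
  exact integral_finsetSum _ fun C _ => integrable_card_goodSelect hX

theorem integral_opt_le (o : Plane) (hβ : 0 ≤ β) (hP : 0 < P)
    (hL : ∀ j i, L.sender j ≠ L.receiver i) (hX : IsShadowing D L P α μ X) :
    ∫ ω, (opt β (fun j i => X j i ω) : ℝ) ∂μ ≤
      ∑ q, ∑ C ∈ L.clusters o q, ∫ ω, (optOn β (fun j i => X j i ω) C : ℝ) ∂μ := by
  have hoptOn (C : Finset (Fin n)) :
      Integrable (fun ω => (optOn β (fun j i => X j i ω) C : ℝ)) μ := integrable_optOn hX.measurable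
  have hsum (q : ZMod 9 × ZMod 9) :
      Integrable (fun ω => ∑ C ∈ L.clusters o q, (optOn β (fun j i => X j i ω) C : ℝ)) μ :=
    integrable_finsetSum _ fun C _ => hoptOn C
  calc ∫ ω, (opt β (fun j i => X j i ω) : ℝ) ∂μ
      ≤ ∫ ω, ∑ q, ∑ C ∈ L.clusters o q, (optOn β (fun j i => X j i ω) C : ℝ) ∂μ := by
        refine integral_mono_ae (integrable_opt hX.measurable)
          (integrable_finsetSum _ fun q _ => hsum q) ?_
        filter_upwards [hX.nonneg hL hP] with ω hω
        exact_mod_cast opt_le_sum_optOn L o hβ hω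
    _ = ∑ q, ∑ C ∈ L.clusters o q, ∫ ω, (optOn β (fun j i => X j i ω) C : ℝ) ∂μ := by
        rw [integral_finsetSum _ fun q _ => hsum q]
        exact sum_congr rfl fun q _ => integral_finsetSum _ fun C _ => hoptOn C

namespace IsRun

variable {ALG : Ω → Finset (Fin n)}

theorem integrable (h : IsRun L P α β c o μ X ALG) : Integrable (fun ω => (#(ALG ω) : ℝ)) μ :=
  have hmeas : Measurable[_, ⊤] ALG :=
    @measurable_to_countable' _ _ ⊤ _ _ ALG h.measurable
  integrable_natCast_of_le (N := n) ((measurable_from_top (f := card)).comp hmeas)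
    fun _ => card_finset_fin_le _

theorem integral_le (h : IsRun L P α β c o μ X ALG) (hX : ∀ j i, Measurable (X j i)) :
    ∫ ω, (#(ALG ω) : ℝ) ∂μ ≤ ∫ ω, (opt β (fun j i => X j i ω) : ℝ) ∂μ := by
  refine integral_mono_ae h.integrable (integrable_opt hX) ?_
  filter_upwards [h.output] with ω hω
  exact Nat.cast_le.2 hω.isFeasible.card_le_opt

theorem sum_integral_card_sparsified_le (h : IsRun L P α β c o μ X ALG)
    (hX : ∀ j i, Measurable (X j i)) :
    ∑ q, ∫ ω, (#(sparsified L P α β c o (fun j i => X j i ω) q) : ℝ) ∂μ ≤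
      81 * ⌈4 * c * β⌉₊ * ∫ ω, (#(ALG ω) : ℝ) ∂μ := by
  rw [← integral_finsetSum _ fun q _ => integrable_card_sparsified hX, ← integral_const_mul]
  refine integral_mono_ae (integrable_finsetSum _ fun q _ => integrable_card_sparsified hX)
    (h.integrable.const_mul _) ?_
  filter_upwards [h.output] with ω hω
  exact_mod_cast hω.sum_card_sparsified_le

end IsRun

end IsFiniteMeasure

variable [IsProbabilityMeasure μ]

theorem integral_card_selected_le (hα : 0 ≤ α) (hβ : 0 ≤ β) (hp : 0 < p) (hc₀ : 0 < c₀)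
    (hη : η ≤ β) (hηc₀ : η ≤ c₀ * 2 ^ (-α)) (htail : ∀ m, 0 < m → p ≤ D.tail m c₀) (hP : 0 < P)
    (hL : ∀ j i, L.sender j ≠ L.receiver i) (hE : L.Equilength univ)
    (hX : IsShadowing D L P α μ X) :
    ∫ ω, (#(selected L P α β o (fun j i => X j i ω) q) : ℝ) ∂μ ≤
      (1 + 1 / p) * ∫ ω, (#(goodSelected L P α β η o (fun j i => X j i ω) q) : ℝ) ∂μ := by
  have hselect (C : Finset (Fin n)) :
      Integrable (fun ω => (#(clusterSelect L P α β (fun j i => X j i ω) C) : ℝ)) μ :=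
    integrable_card_clusterSelect hX.measurable
  calc ∫ ω, (#(selected L P α β o (fun j i => X j i ω) q) : ℝ) ∂μ
      ≤ ∫ ω, ∑ C ∈ L.clusters o q, (#(clusterSelect L P α β (fun j i => X j i ω) C) : ℝ) ∂μ :=
        integral_mono (integrable_card_selected hX.measurable)
          (integrable_finsetSum _ fun C _ => hselect C) fun ω => by
            simp only [← Nat.cast_sum]
            exact Nat.cast_le.2 card_selected_le
    _ = ∑ C ∈ L.clusters o q, ∫ ω, (#(clusterSelect L P α β (fun j i => X j i ω) C) : ℝ) ∂μ :=
        integral_finsetSum _ fun C _ => hselect C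
    _ ≤ ∑ C ∈ L.clusters o q,
          (1 + 1 / p) * ∫ ω, (#(goodSelect L P α β η (fun j i => X j i ω) C) : ℝ) ∂μ :=
        sum_le_sum fun C hC =>
          integral_card_clusterSelect_le hα hβ hp hc₀ hη hηc₀ htail hP hL
            (hE.mono (subset_univ C)) (LinkSet.nonempty_of_mem_clusters hC) hX
    _ = (1 + 1 / p) * ∫ ω, (#(goodSelected L P α β η o (fun j i => X j i ω) q) : ℝ) ∂μ := by
        rw [← mul_sum, integral_card_goodSelected hβ hP.le hX.measurable]

/- Markov's inequality: the expected affectance on the good selected links is at most `c` times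
their expected number, so at least half of them, in expectation, survive the bound `2 * c`. -/
theorem integral_card_goodSelected_le (hα : 0 ≤ α) (hβ : 0 ≤ β) (hp : 0 < p) (hc₀ : 0 < c₀)
    (hη : η ≤ β) (hηc₀ : η ≤ c₀ * 2 ^ (-α)) (htail : ∀ m, 0 < m → p ≤ D.tail m c₀) (hP : 0 < P)
    (hL : ∀ j i, L.sender j ≠ L.receiver i) (hE : L.Equilength univ) (hK₀ : 0 ≤ K)
    (hK : ∀ x, ∀ i ∈ L.gridClass o q,
      ∑ j ∈ goodSelected L P α β η o x q, L.gain P α i j / x j j ≤ K)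
    (hX : IsShadowing D L P α μ X) (hc : 0 < c) (hKc : K * (1 + 1 / p) ≤ c) :
    ∫ ω, (#(goodSelected L P α β η o (fun j i => X j i ω) q) : ℝ) ∂μ ≤
      2 * ∫ ω, (#(sparsified L P α β c o (fun j i => X j i ω) q) : ℝ) ∂μ := by
  set G := ∫ ω, (#(goodSelected L P α β η o (fun j i => X j i ω) q) : ℝ) ∂μ
  set R := ∫ ω, (#(sparsified L P α β c o (fun j i => X j i ω) q) : ℝ) ∂μ
  set a := fun ω => ∑ j ∈ goodSelected L P α β η o (fun j i => X j i ω) q,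
    affectance (fun j i => X j i ω) (selected L P α β o (fun j i => X j i ω) q) j
  have hR := integrable_card_sparsified (μ := μ) (L := L) (P := P) (α := α) (β := β) (c := c)
    (o := o) (q := q) hX.measurable
  have ha : Integrable a μ := integrable_sum_affectance hβ hP hL hK₀ hK hX
  have hmarkov : G ≤ R + (∫ ω, a ω ∂μ) / (2 * c) := by
    rw [← integral_div, ← integral_add hR (ha.div_const _)]
    refine integral_mono_ae (integrable_card_goodSelected hX.measurable)
      (hR.add (ha.div_const _)) ?_
    filter_upwards [hX.nonneg hL hP] with ω hω
    exact card_goodSelected_le hc hω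
  have haffectance : ∫ ω, a ω ∂μ ≤ c * G :=
    calc ∫ ω, a ω ∂μ ≤ K * ∫ ω, (#(selected L P α β o (fun j i => X j i ω) q) : ℝ) ∂μ :=
          integral_sum_affectance_le hβ hP hL hK₀ hK hX
      _ ≤ K * ((1 + 1 / p) * G) := by
          gcongr
          exact integral_card_selected_le hα hβ hp hc₀ hη hηc₀ htail hP hL hE hX
      _ ≤ c * G := by
          rw [← mul_assoc]
          gcongr
  have hhalf : (∫ ω, a ω ∂μ) / (2 * c) ≤ G / 2 := by
    rw [div_le_div_iff₀ (by positivity) two_pos]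
    linarith
  linarith

end Expectation

section Main

open Finset

theorem exists_sum_goodSelected_gain_div_le {α β η : ℝ} (hα : 2 < α) (hβ : 0 ≤ β) (hη : 0 < η) :
    ∃ K : ℝ, 0 < K ∧ ∀ (n : ℕ) (L : LinkSet n) (P : ℝ), 0 < P →
      (∀ j i, L.sender j ≠ L.receiver i) → L.Equilength univ →
      ∀ (o : Plane) (q : ZMod 9 × ZMod 9) (x : Fin n → Fin n → ℝ), ∀ i ∈ L.gridClass o q,
        ∑ j ∈ goodSelected L P α β η o x q, L.gain P α i j / x j j ≤ K := by
  obtain ⟨Z, hZ₀, hZ⟩ := exists_sum_one_add_dist_rpow_le hα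
  exact ⟨16 ^ α / η * Z, by positivity, fun n L P hP hL hE o q x i hi =>
    sum_goodSelected_gain_div_le (by linarith) hβ hη hP hL hE hZ hi⟩

theorem exists_integral_opt_le {α β p : ℝ} (hα : 2 < α) (hβ : 0 < β) (hp : 0 < p)
    {D : SSDistribution} (hD : D.IsSmooth p) (hg : D.HasLogGrowth) :
    ∃ c : ℝ, 0 < c ∧ ∃ M : ℝ, 0 < M ∧ ∀ (n : ℕ) (L : LinkSet n) (P : ℝ), 0 < P →
      (∀ j i, L.sender j ≠ L.receiver i) → L.Equilength univ → ∀ (o : Plane) {Ω : Type*}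
      [MeasurableSpace Ω] (μ : Measure Ω) [IsProbabilityMeasure μ] (X : Fin n → Fin n → Ω → ℝ),
      IsShadowing D L P α μ X → ∀ ALG : Ω → Finset (Fin n), IsRun L P α β c o μ X ALG →
        ∫ ω, (opt β (fun j i => X j i ω) : ℝ) ∂μ ≤ M * ∫ ω, (#(ALG ω) : ℝ) ∂μ := by
  obtain ⟨c₀, hc₀, htail⟩ := hD.exists_le_tail
  obtain ⟨η, hη₀, hη, hηc₀⟩ : ∃ η, 0 < η ∧ η ≤ β ∧ η ≤ c₀ * 2 ^ (-α) :=
    ⟨min β (c₀ * 2 ^ (-α)), lt_min hβ (by positivity), min_le_left _ _, min_le_right _ _⟩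
  have hα₀ : 0 ≤ α := by linarith
  obtain ⟨M, hM, hoptOn⟩ := exists_integral_optOn_le hα₀ hβ hp hc₀ hη hηc₀ htail hg
  obtain ⟨K, hK₀, hK⟩ := exists_sum_goodSelected_gain_div_le hα hβ.le hη₀
  set c := K * (1 + 1 / p)
  have hc : 0 < c := by positivity
  refine ⟨c, hc, M * (2 * (81 * ⌈4 * c * β⌉₊)), by positivity, ?_⟩
  intro n L P hP hL hE o Ω _ μ _ X hX ALG hALG
  calc ∫ ω, (opt β (fun j i => X j i ω) : ℝ) ∂μ
      ≤ ∑ q, ∑ C ∈ L.clusters o q, ∫ ω, (optOn β (fun j i => X j i ω) C : ℝ) ∂μ :=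
        integral_opt_le o hβ.le hP hL hX
    _ ≤ ∑ q, ∑ C ∈ L.clusters o q,
          M * ∫ ω, (#(goodSelect L P α β η (fun j i => X j i ω) C) : ℝ) ∂μ :=
        sum_le_sum fun q _ => sum_le_sum fun C hC => hoptOn n L P hP hL hE o q C hC μ X hX
    _ = M * ∑ q, ∫ ω, (#(goodSelected L P α β η o (fun j i => X j i ω) q) : ℝ) ∂μ := by
        simp only [integral_card_goodSelected hβ.le hP.le hX.measurable, mul_sum]
    _ ≤ M * ∑ q, 2 * ∫ ω, (#(sparsified L P α β c o (fun j i => X j i ω) q) : ℝ) ∂μ := by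
        gcongr with q
        exact integral_card_goodSelected_le hα₀ hβ.le hp hc₀ hη hηc₀ htail hP hL hE hK₀.le
          (hK n L P hP hL hE o q) hX hc le_rfl
    _ ≤ M * (2 * (81 * ⌈4 * c * β⌉₊ * ∫ ω, (#(ALG ω) : ℝ) ∂μ)) := by
        rw [← mul_sum]
        gcongr
        exact hALG.sum_integral_card_sparsified_le hX.measurable
    _ = M * (2 * (81 * ⌈4 * c * β⌉₊)) * ∫ ω, (#(ALG ω) : ℝ) ∂μ := by ring

end Main

theorem mainTheorem2_general (α β p : ℝ) (hα : 2 < α) (hβ : 0 < β) (hp : 0 < p)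
    (D : SSDistribution) (hD : D.IsSmooth p) (hg : D.HasLogGrowth) :
    ∃ c : ℝ, 0 < c ∧ ∃ A : ℝ, 0 < A ∧ ∃ B : ℝ, 0 < B ∧
      ∀ (n : ℕ) (L : LinkSet n) (P : ℝ), 0 < P →
        (∀ j i, L.sender j ≠ L.receiver i) → L.Equilength Finset.univ →
        ∀ o : Plane,
          (∀ q, L.IsWellSeparated (L.gridClass o q) (L.clusters o q)) ∧
          ∀ (Ω : Type*) [MeasurableSpace Ω] (μ : Measure Ω) [IsProbabilityMeasure μ]
            (X : Fin n → Fin n → Ω → ℝ), IsShadowing D L P α μ X →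
            (∃ ALG : Ω → Finset (Fin n), IsRun L P α β c o μ X ALG) ∧
            ∀ ALG : Ω → Finset (Fin n), IsRun L P α β c o μ X ALG →
              A * ∫ ω, (opt β (fun j i => X j i ω) : ℝ) ∂μ ≤ ∫ ω, ((ALG ω).card : ℝ) ∂μ ∧
              ∫ ω, ((ALG ω).card : ℝ) ∂μ ≤ B * ∫ ω, (opt β (fun j i => X j i ω) : ℝ) ∂μ := by
  obtain ⟨c, hc, M, hM, hopt⟩ := exists_integral_opt_le hα hβ hp hD hg
  refine ⟨c, hc, M⁻¹, inv_pos.2 hM, 1, one_pos, fun n L P hP hL hE o =>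
    ⟨LinkSet.isWellSeparated_gridClass hL hE o, fun Ω _ μ _ X hX =>
      ⟨exists_isRun hX.measurable (hX.nonneg hL hP) hβ hc hP.le, fun ALG hALG => ⟨?_, ?_⟩⟩⟩⟩
  · rw [inv_mul_le_iff₀ hM]
    exact hopt n L P hP hL hE o μ X hX ALG hALG
  · rw [one_mul]
    exact hALG.integral_le hX.measurable

theorem mainTheorem2 (α β p : ℝ) (hα : 2 < α) (hβ : 1 ≤ β) (hp0 : 0 < p) (hp1 : p < 1)
    (D : SSDistribution) (hD : D.IsSmooth p) (hg : D.HasLogGrowth) :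
    ∃ c : ℝ, 0 < c ∧ ∃ A : ℝ, 0 < A ∧ ∃ B : ℝ, 0 < B ∧
      ∀ (n : ℕ) (L : LinkSet n) (P : ℝ), 0 < P →
        (∀ j i, L.sender j ≠ L.receiver i) → L.Equilength Finset.univ →
        ∀ o : Plane,
          (∀ q, L.IsWellSeparated (L.gridClass o q) (L.clusters o q)) ∧
          ∀ (Ω : Type*) [MeasurableSpace Ω] (μ : Measure Ω) [IsProbabilityMeasure μ]
            (X : Fin n → Fin n → Ω → ℝ), IsShadowing D L P α μ X →
            (∃ ALG : Ω → Finset (Fin n), IsRun L P α β c o μ X ALG) ∧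
            ∀ ALG : Ω → Finset (Fin n), IsRun L P α β c o μ X ALG →
              A * ∫ ω, (opt β (fun j i => X j i ω) : ℝ) ∂μ ≤ ∫ ω, ((ALG ω).card : ℝ) ∂μ ∧
              ∫ ω, ((ALG ω).card : ℝ) ∂μ ≤ B * ∫ ω, (opt β (fun j i => X j i ω) : ℝ) ∂μ :=
  mainTheorem2_general α β p hα (zero_lt_one.trans_le hβ) hp0 D hD hg
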